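/- Simplicial complexes are finite and abstract, the empty set is a face of each of them, and isomorphic complexes are identified. Let $X$ be a complex of dimension $e$ containing an induced subcomplex of the form $\overline{\alpha}*\partial\beta$ of dimension $e$, where $\alpha,\beta$ are disjoint non-empty finite sets, $\overline{\alpha}$ is the complex of all subsets of $\alpha$, $\partial\beta$ is the complex of all proper subsets of $\beta$, and "induced" means that $\overline{\alpha}*\partial\beta$ consists of all faces of $X$ contained in $\alpha\cup\beta$. The complex $Y=(X\setminus(\overline{\alpha}*\partial\beta))\cup(\partial\alpha*\overline{\beta})$ is then said to arise from $X$ by a bistellar move of index $\dim\beta=\#\beta-1$. An $e$-dimensional complex is called $k$-stellated if it arises, by a finite sequence of bistellar moves each of index $<k$, from the standard sphere $S^{e}_{e+2}$, i.e. from the boundary complex of the $(e+1)$-simplex. For $0\le k\le d$, $\mathcal W_k(d)$ is the class of connected $d$-dimensional complexes all of whose vertex links are $k$-stellated spheres of dimension $d-1$. A complex is $2$-neighbourly if any two of its vertices form a face. For a $d$-dimensional complex $M$ let $f_i$ be the number of its $i$-dimensional faces ($f_{-1}=1$), and let $$g_j=\sum_{i=-1}^{j-1}(-1)^{j-i-1}\binom{d-i+1}{j-i-1}f_i\qquad(0\le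 j\le d+1).$$ Let $\mathbb F$ be an arbitrary field and $\beta_i=\dim_{\mathbb F}H_i(M;\mathbb F)$, where $H_i$ is (unreduced) simplicial homology. **Theorem.** Let $M\in\mathcal W_k(d)$ be $2$-neighbourly. Then: (a) if $d=2k$, then $g_{l+1}\ge\binom{d+2}{l+1}\sum_{i=1}^{l}(-1)^{l-i}\beta_i$ for $1\le l\le k-1$; (b) if $d\ge 2k+1$, then $g_{l+1}\ge\binom{d+2}{l+1}\sum_{i=1}^{l}(-1)^{l-i}\beta_i$ for $1\le l\le k$; (c) if $d\ge 2k+2$, then $g_{l+1}=\binom{d+2}{l+1}\sum_{i=1}^{l}(-1)^{l-i}\beta_i$ for $k\le l\le d-k-1$; (d) if $d\ge 2k+2$, then $\beta_i=0$ for $k+1\le i\le d-k-1$. -/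

import Mathlib

/-- A finite abstract simplicial complex with vertices in `V`. As usual in the theory of bistellar
moves, the empty set is a face of every complex, and an element of `V` need not be a vertex. -/
@[ext]
structure FiniteComplex (V : Type*) where
  faces : Finset (Finset V)
  empty_mem : ∅ ∈ faces
  down_closed : ∀ s ∈ faces, ∀ t, t ⊆ s → t ∈ faces

namespace FiniteComplex

variable {V W : Type*}

/-- `v` is a vertex of `X`. -/
def IsVertex (X : FiniteComplex V) (v : V) : Prop := {v} ∈ X.faces

/-- The dimension of a complex; it is `-1` for the complex `{∅}`. -/
def dim (X : FiniteComplex V) : ℤ := ((X.faces.sup Finset.card : ℕ) : ℤ) - 1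

/-- The faces with exactly `n` vertices, i.e. those of dimension `n - 1`. -/
def facesOfCard (X : FiniteComplex V) (n : ℕ) : Finset (Finset V) :=
  X.faces.filter (fun s => s.card = n)

/-- The graph formed by the vertices and edges of `X`. -/
def edgeGraph (X : FiniteComplex V) [DecidableEq V] : SimpleGraph {v : V // X.IsVertex v} where
  Adj u v := u ≠ v ∧ {u.1, v.1} ∈ X.faces
  symm := ⟨fun u v h => ⟨h.1.symm, by rw [Finset.pair_comm]; exact h.2⟩⟩
  loopless := ⟨fun _ h => h.1 rfl⟩

/-- `X` is connected (equivalently, its geometric carrier is): any two vertices are joined by a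
path of edges, and there is a vertex. -/
def IsConnected (X : FiniteComplex V) [DecidableEq V] : Prop := X.edgeGraph.Connected

/-- `X` is `l`-neighbourly: any `l` vertices form a face. -/
def IsNeighbourly (l : ℕ) (X : FiniteComplex V) : Prop :=
  ∀ s : Finset V, (∀ v ∈ s, X.IsVertex v) → s.card = l → s ∈ X.faces

/-- The link of a vertex. -/
def link [DecidableEq V] (X : FiniteComplex V) (x : V) (hx : X.IsVertex x) : FiniteComplex V where
  faces := X.faces.filter (fun s => x ∉ s ∧ insert x s ∈ X.faces)
  empty_mem := by
    have hx' : {x} ∈ X.faces := hx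
    simpa [X.empty_mem] using hx'
  down_closed := by
    intro s hs t hts
    simp only [Finset.mem_filter] at hs ⊢
    exact ⟨X.down_closed s hs.1 t hts, fun h => hs.2.1 (hts h),
      X.down_closed _ hs.2.2 _ (Finset.insert_subset_insert x hts)⟩

/-- The boundary complex `∂α` of a simplex: all proper subsets of `α`. If `α` has `n` elements,
this is the standard sphere of dimension `n - 2` with `n` vertices. -/
def simplexBoundary [DecidableEq V] (α : Finset V) (hα : α.Nonempty) : FiniteComplex V where
  faces := α.ssubsets
  empty_mem := by
    rw [Finset.mem_ssubsets]; exact Finset.empty_ssubset.2 hα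
  down_closed := by
    intro s hs t hts
    rw [Finset.mem_ssubsets] at hs ⊢
    exact lt_of_le_of_lt hts hs

/-- The faces of the join of two complexes on disjoint vertex sets, given by their faces. -/
def joinFaces [DecidableEq V] (A B : Finset (Finset V)) : Finset (Finset V) :=
  Finset.image₂ (fun s t => s ∪ t) A B

/-- `Y` is obtained from `X` by the bistellar move `α ↦ β`: the complex `ᾱ * ∂β`, of the same
dimension as `X`, is the subcomplex of `X` induced on `α ∪ β`, and it is replaced by `∂α * β̄`.
The index of the move is `dim β`, i.e. `β.card - 1`. -/
structure IsBistellarMove [DecidableEq V] (X Y : FiniteComplex V) (α β : Finset V) : Prop where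
  nonempty_left : α.Nonempty
  nonempty_right : β.Nonempty
  disjoint : Disjoint α β
  dim_eq : ((α.card : ℤ) - 1) + ((β.card : ℤ) - 1) = X.dim
  induced : X.faces.filter (fun s => s ⊆ α ∪ β) = joinFaces α.powerset β.ssubsets
  faces_eq : Y.faces =
    (X.faces \ joinFaces α.powerset β.ssubsets) ∪ joinFaces α.ssubsets β.powerset

/-- The complexes with vertices in `ℕ` that arise from the boundary of a simplex by finitely many
bistellar moves, each of index less than `k`. -/
inductive StellatedNat (k : ℕ) : FiniteComplex ℕ → Prop
  | standard (α : Finset ℕ) (hα : α.Nonempty) : StellatedNat k (simplexBoundary α hα)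
  | move (X Y : FiniteComplex ℕ) (α β : Finset ℕ) (hX : StellatedNat k X)
      (hmove : IsBistellarMove X Y α β) (hindex : (β.card : ℤ) - 1 < k) : StellatedNat k Y

/-- Two complexes are isomorphic: some relabelling, injective on the vertices of the first one,
carries its faces onto those of the second. -/
def IsIsomorphic [DecidableEq W] (X : FiniteComplex V) (Y : FiniteComplex W) : Prop :=
  ∃ f : V → W, Set.InjOn f {v | X.IsVertex v} ∧ Y.faces = X.faces.image (Finset.image f)

/-- `X` is `k`-stellated. Isomorphic complexes are identified, and a vertex set with an unlimited
supply of labels is used since moves of index `0` create new vertices. Moves preserve the dimension,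
so `X` arises from the standard sphere of its own dimension. -/
def IsStellated (k : ℕ) (X : FiniteComplex V) : Prop :=
  ∃ Y : FiniteComplex ℕ, StellatedNat k Y ∧ X.IsIsomorphic Y

/-- The class `𝒲_k(d)`: connected complexes of dimension `d` all of whose vertex links are
`k`-stellated spheres of dimension `d - 1`. -/
structure MemW [DecidableEq V] (k d : ℕ) (X : FiniteComplex V) : Prop where
  connected : X.IsConnected
  dim_eq : X.dim = d
  link_dim : ∀ (x : V) (hx : X.IsVertex x), (X.link x hx).dim = (d : ℤ) - 1
  link_stellated : ∀ (x : V) (hx : X.IsVertex x), (X.link x hx).IsStellated k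

/-- The component `g_j` of the `g`-vector of a complex of dimension `d`, for `j ≤ d + 1`:
`g_j = ∑_{i=-1}^{j-1} (-1)^(j-i-1) C(d-i+1, j-i-1) f_i`, where `f_i` is the number of faces of
dimension `i`; the summation index below is `c = i + 1`. -/
def gNumber (X : FiniteComplex V) (d j : ℕ) : ℤ :=
  ∑ c ∈ Finset.range (j + 1),
    (-1) ^ (j - c) * ((d + 2 - c).choose (j - c) : ℤ) * ((X.facesOfCard c).card : ℤ)

section Homology

variable [LinearOrder V]

/-- The incidence number of `t` in the boundary of the simplex `s`, whose vertices are listed in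
increasing order: `∂[v₀, …, vₙ] = ∑ (-1)^p [v₀, …, v̂_p, …, vₙ]`. -/
def incidence (s t : Finset V) : ℤ :=
  ∑ v ∈ s, if s.erase v = t then (-1) ^ (s.filter (fun w => w < v)).card else 0

variable (X : FiniteComplex V) (F : Type*) [Field F]

/-- Simplicial `i`-chains with coefficients in `F`. -/
abbrev Chain (i : ℕ) : Type _ := X.facesOfCard (i + 1) → F

/-- The boundary map from `(i+1)`-chains to `i`-chains. -/
def boundary (i : ℕ) : X.Chain F (i + 1) →ₗ[F] X.Chain F i :=
  Matrix.mulVecLin (Matrix.of fun t s => (incidence s.1 t.1 : F))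

/-- Simplicial `i`-cycles; all `0`-chains are cycles. -/
def cycles : (i : ℕ) → Submodule F (X.Chain F i)
  | 0 => ⊤
  | i + 1 => LinearMap.ker (X.boundary F i)

/-- The (unreduced) simplicial homology `H_i(X; F)`: cycles modulo boundaries. -/
abbrev Homology (i : ℕ) : Type _ :=
  X.cycles F i ⧸ (LinearMap.range (X.boundary F i)).submoduleOf (X.cycles F i)

/-- The Betti number `β_i(X) = dim H_i(X; F)`. -/
noncomputable def betti (i : ℕ) : ℕ := Module.finrank F (X.Homology F i)

end Homology

end FiniteComplex

/-! For a family of faces, `truncEuler` at c is the alternating sum of the reduced Betti numbers in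
dimensions below c, written as a truncated Euler characteristic minus one boundary rank. Lower
bounds for ranks are therefore upper bounds for it. For connected M its value at l + 1 is the Betti
sum of the theorem, so (a) and (b) say that `truncEuler` is at most `normG` in degree l + 1; this is
proved whenever l + k + 1 ≤ d.

Build M one vertex at a time. Passing from M[A] to M[A ∪ {x}] raises `truncEuler` by at most its
value, one degree lower, on the link of x restricted to A (`truncEuler_insert_le`). Averaging over
all vertex orders bounds M by the sum over x of `inducedEuler` of the links, plus the term of the
empty face (`truncEuler_le_sum_link`). The averaging weights do not notice elements outside a link,
so only the link itself matters.

A stellated sphere of dimension E - 2 satisfies `inducedEuler` ≤ 1/(E + 1) times the alternating sum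
of g_j / C(E, j) (`HasStellatedBounds`). A move α ↦ β adds 1 to g in degree |β|. In the sizes
considered it contributes at most (-1)^(c - |β|) to `truncEuler` on those A that meet α ∪ β exactly
in β, and nothing positive elsewhere; such A have total weight 1 / ((E + 1) C(E, |β|)). Both sides
of the bound thus change alike.

Summed over the links of M, the normalised g-numbers become G (j + 1) + G j with G = `normG`, and
their alternating sum telescopes.

If d ≥ 2k + 2, the g-numbers of the links vanish between k and d - k, so G (j + 1) = -G j there,
while two consecutive values of `truncEuler` add up to a Betti number, hence to something
non-negative. The upper bound in a neighbouring degree then becomes a lower bound; equality follows,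
and those Betti numbers vanish. -/

namespace FiniteComplex

/-! ### Linear algebra: boundary ranks of families of faces. -/

open Submodule Module

/-- Rank-nullity for π on the span of U: S lies in the kernel, π(T) in the range. It is applied with
a projection that kills the old boundaries and still separates the new ones. -/
theorem finrank_span_add_finrank_span_map_le {F E E' : Type*} [Field F] [AddCommGroup E]
    [Module F E] [AddCommGroup E'] [Module F E'] (π : E →ₗ[F] E') {S T U : Set E}
    (hU : U.Finite) (hS : S ⊆ U) (hT : T ⊆ U) (hπ : ∀ s ∈ S, π s = 0) :
    finrank F (span F S) + finrank F (span F (π '' T)) ≤ finrank F (span F U) := by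
  have : FiniteDimensional F (span F U) := FiniteDimensional.span_of_finite F hU
  have h := LinearMap.finrank_range_add_finrank_ker (π.domRestrict (span F U))
  have h1 : finrank F (span F (π '' T)) ≤ finrank F (π.domRestrict (span F U)).range := by
    have : span F (π '' T) ≤ (π.domRestrict (span F U)).range := by
      rw [span_le]
      rintro _ ⟨t, ht, rfl⟩
      exact ⟨⟨t, subset_span (hT ht)⟩, rfl⟩
    exact Submodule.finrank_mono this
  have h2 : finrank F (span F S) ≤ finrank F (π.domRestrict (span F U)).ker := by
    have hle : span F S ≤ span F U := span_mono hS
    have hker : span F S ≤ LinearMap.ker π := by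
      rw [span_le]; intro s hs; exact hπ s hs
    let i : span F S →ₗ[F] (π.domRestrict (span F U)).ker :=
      LinearMap.codRestrict _ (Submodule.inclusion hle) (fun x => hker x.2)
    refine LinearMap.finrank_le_finrank_of_injective (f := i) ?_
    intro x y hxy
    exact Subtype.ext (congrArg (fun z : (π.domRestrict (span F U)).ker => (z.1 : E)) hxy)
  omega

section Boundary

variable {V : Type*} [LinearOrder V] (F : Type*) [Field F]

/-- The boundary of the simplex `s` in the augmented chain complex of all finite subsets of `V`. -/
noncomputable def simplexBdry (s : Finset V) : Finset V →₀ F :=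
  ∑ v ∈ s, Finsupp.single (s.erase v) ((-1 : F) ^ (s.filter (fun w => w < v)).card)

theorem simplexBdry_apply (s t : Finset V) : simplexBdry F s t = (incidence s t : F) := by
  simp [simplexBdry, incidence, Finsupp.finsetSum_apply, Finsupp.single_apply]

/-- The rank of the boundary map on the members of `K` with `c` elements. -/
noncomputable def bdryRank (K : Finset (Finset V)) (c : ℕ) : ℕ :=
  finrank F (span F (simplexBdry F '' {s | s ∈ K ∧ s.card = c}))

theorem finite_simplexBdry_image (K : Finset (Finset V)) (c : ℕ) :
    (simplexBdry F '' {s | s ∈ K ∧ s.card = c}).Finite :=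
  (K.finite_toSet.subset fun _ hs => hs.1).image _

theorem bdryRank_mono {K K' : Finset (Finset V)} {c : ℕ}
    (h : ∀ s ∈ K, s.card = c → s ∈ K') : bdryRank F K c ≤ bdryRank F K' c := by
  have : FiniteDimensional F (span F (simplexBdry F '' {s | s ∈ K' ∧ s.card = c})) :=
    FiniteDimensional.span_of_finite F (finite_simplexBdry_image F K' c)
  refine Submodule.finrank_mono (span_mono (Set.image_mono ?_))
  rintro s ⟨hs, hc⟩
  exact ⟨h s hs hc, hc⟩

/-- Adding the faces that are cones with apex `a` over a family of new faces raises the rank of the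
boundary map by at least the number of these faces. -/
theorem bdryRank_add_card_le {K K' N : Finset (Finset V)} {c : ℕ} (a : V)
    (hK : ∀ s ∈ K, s.card = c + 1 → s ∈ K')
    (hN : ∀ s ∈ N, a ∉ s ∧ s.card = c ∧ insert a s ∈ K')
    (hKN : ∀ s ∈ K, s.card = c + 1 → ∀ t ∈ N, ¬ t ⊆ s) :
    bdryRank F K (c + 1) + N.card ≤ bdryRank F K' (c + 1) := by
  classical
  -- π keeps the coordinates in N. It kills the boundaries from K, whose faces contain no member of
  -- N, and sends the boundary of `insert a t` to ± t, because every other facet contains a.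
  let π : (Finset V →₀ F) →ₗ[F] (Finset V →₀ F) :=
    Finsupp.linearCombination F fun t => if t ∈ N then Finsupp.single t 1 else 0
  have hπ : ∀ s : Finset V, π (simplexBdry F s) = ∑ v ∈ s,
      if s.erase v ∈ N then
        Finsupp.single (s.erase v) ((-1 : F) ^ (s.filter (fun w => w < v)).card) else 0 := by
    intro s
    simp only [π, simplexBdry, map_sum, Finsupp.linearCombination_single]
    refine Finset.sum_congr rfl fun v _ => ?_
    split_ifs <;> simp
  have hπN : ∀ s ∈ N, π (simplexBdry F (insert a s)) = Finsupp.single s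
      ((-1 : F) ^ ((insert a s).filter (fun w => w < a)).card) := by
    intro s hs
    rw [hπ, Finset.sum_eq_single a]
    · rw [Finset.erase_insert (hN s hs).1, if_pos hs]
    · intro v hv hva
      rw [if_neg]
      intro h
      exact (hN _ h).1 (Finset.mem_erase.2 ⟨hva.symm, Finset.mem_insert_self _ _⟩)
    · intro h; exact absurd (Finset.mem_insert_self _ _) h
  have key := finrank_span_add_finrank_span_map_le π
    (S := simplexBdry F '' {s | s ∈ K ∧ s.card = c + 1})
    (T := simplexBdry F '' {s | ∃ t ∈ N, insert a t = s})
    (finite_simplexBdry_image F K' (c + 1))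
    (Set.image_mono fun s hs => ⟨hK s hs.1 hs.2, hs.2⟩)
    (Set.image_mono (by
      rintro _ ⟨t, ht, rfl⟩
      exact ⟨(hN t ht).2.2, by rw [Finset.card_insert_of_notMem (hN t ht).1, (hN t ht).2.1]⟩))
    (by
      rintro _ ⟨s, ⟨hs, hc⟩, rfl⟩
      rw [hπ]
      refine Finset.sum_eq_zero fun v _ => if_neg fun h => ?_
      exact hKN s hs hc _ h (Finset.erase_subset _ _))
  refine le_trans (Nat.add_le_add_left ?_ _) key
  have hli : LinearIndependent F fun t : N => (Finsupp.single t.1 (1 : F) : Finset V →₀ F) :=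
    (Finsupp.linearIndependent_single_one F (Finset V)).comp _ Subtype.val_injective
  have hcard := finrank_span_eq_card hli
  rw [Fintype.card_coe] at hcard
  rw [← hcard]
  have : FiniteDimensional F (span F (π '' (simplexBdry F '' {s | ∃ t ∈ N, insert a t = s}))) :=
    FiniteDimensional.span_of_finite F (Set.Finite.image _ (Set.Finite.image _
      ((N.finite_toSet.image (insert a)).subset (by rintro _ ⟨t, ht, rfl⟩; exact ⟨t, ht, rfl⟩))))
  refine Submodule.finrank_mono ?_
  rw [span_le]
  rintro _ ⟨t, rfl⟩
  have h1 : π (simplexBdry F (insert a t.1)) ∈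
      span F (π '' (simplexBdry F '' {s | ∃ t ∈ N, insert a t = s})) :=
    subset_span ⟨_, ⟨_, ⟨t.1, t.2, rfl⟩, rfl⟩, rfl⟩
  rw [hπN t.1 t.2] at h1
  have h2 := Submodule.smul_mem _ ((-1 : F) ^ ((insert a t.1).filter (fun w => w < a)).card) h1
  rw [Finsupp.smul_single, smul_eq_mul, ← mul_pow] at h2
  simpa using h2

theorem finrank_span_le_of_map {E E' : Type*} [AddCommGroup E] [Module F E] [AddCommGroup E']
    [Module F E'] (π : E →ₗ[F] E') {S : Set E} {T : Set E'} (hS : S.Finite)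
    (h : ∀ t ∈ T, ∃ s ∈ S, ∃ u : F, t = u • π s) :
    finrank F (span F T) ≤ finrank F (span F S) := by
  have : FiniteDimensional F (span F S) := FiniteDimensional.span_of_finite F hS
  refine le_trans (Submodule.finrank_mono (t := (span F S).map π) ?_) (finrank_map_le π _)
  rw [span_le]
  intro t ht
  obtain ⟨s, hs, u, rfl⟩ := h t ht
  exact Submodule.smul_mem _ _ (Submodule.mem_map_of_mem (subset_span hs))

theorem card_filter_insert_lt {s : Finset V} {x v : V} (hx : x ∉ s) :
    ((insert x s).filter (fun w => w < v)).card
      = (s.filter (fun w => w < v)).card + if x < v then 1 else 0 := by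
  rw [Finset.filter_insert]
  split_ifs
  · rw [Finset.card_insert_of_notMem (by simp [hx])]
  · rfl

theorem card_filter_erase_gt {s : Finset V} {x v : V} (hv : v ∈ s) :
    ((s.erase v).filter (fun w => x < w)).card + (if x < v then 1 else 0)
      = (s.filter (fun w => x < w)).card := by
  rw [Finset.filter_erase]
  split_ifs with h
  · rw [Finset.card_erase_add_one (by simp [hv, h])]
  · rw [Finset.erase_eq_of_notMem (by simp [h]), add_zero]

/-- The faces of `K` within `A` and those of the link of `x` within `A` contribute independently
to the rank of the boundary map. -/
theorem bdryRank_add_link_le {K K₀ L : Finset (Finset V)} {c : ℕ} (x : V)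
    (hK₀ : ∀ s ∈ K₀, s ∈ K ∧ x ∉ s) (hL : ∀ s ∈ L, insert x s ∈ K ∧ x ∉ s) :
    bdryRank F K₀ (c + 1) + bdryRank F L c ≤ bdryRank F K (c + 1) := by
  classical
  -- ε is the sign of moving x to the last place. With x last, deleting another vertex has the same
  -- sign as in the link, so π turns the boundary of `insert x s` into that of s up to sign.
  let ε : Finset V → F := fun t => (-1) ^ (t.filter (fun w => x < w)).card
  let π : (Finset V →₀ F) →ₗ[F] (Finset V →₀ F) :=
    Finsupp.linearCombination F fun t =>
      if x ∈ t then Finsupp.single (t.erase x) (ε (t.erase x)) else 0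
  have hπ : ∀ s : Finset V, x ∉ s →
      π (simplexBdry F (insert x s)) = ε s • simplexBdry F s := by
    intro s hs
    rw [simplexBdry, map_sum, Finset.sum_insert hs]
    simp only [π, Finsupp.linearCombination_single, Finset.erase_insert hs, if_neg hs, smul_zero,
      zero_add, simplexBdry, Finset.smul_sum]
    refine Finset.sum_congr rfl fun v hv => ?_
    have hvx : v ≠ x := fun h => hs (h ▸ hv)
    have hxm : x ∈ (insert x s).erase v := by simp [hvx.symm]
    have her : ((insert x s).erase v).erase x = s.erase v := by
      rw [Finset.erase_right_comm, Finset.erase_insert hs]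
    rw [if_pos hxm, her, card_filter_insert_lt hs, Finsupp.smul_single, Finsupp.smul_single]
    congr 1
    simp only [ε, smul_eq_mul, ← card_filter_erase_gt (x := x) hv]
    split_ifs <;> ring
  have key := finrank_span_add_finrank_span_map_le π
    (S := simplexBdry F '' {s | s ∈ K₀ ∧ s.card = c + 1})
    (T := simplexBdry F '' {s | ∃ t, (t ∈ L ∧ t.card = c) ∧ insert x t = s})
    (finite_simplexBdry_image F K (c + 1))
    (Set.image_mono fun s hs => ⟨(hK₀ s hs.1).1, hs.2⟩)
    (Set.image_mono (by
      rintro _ ⟨t, ht, rfl⟩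
      exact ⟨(hL t ht.1).1, by rw [Finset.card_insert_of_notMem (hL t ht.1).2, ht.2]⟩))
    (by
      rintro _ ⟨s, ⟨hs, hc⟩, rfl⟩
      rw [simplexBdry, map_sum]
      refine Finset.sum_eq_zero fun v _ => ?_
      simp [π, (hK₀ s hs).2])
  refine le_trans (Nat.add_le_add_left ?_ _) key
  refine finrank_span_le_of_map F LinearMap.id (Set.Finite.image _ (Set.Finite.image _ ?_)) ?_
  · exact ((L.finite_toSet.image (insert x)).subset
      (by rintro _ ⟨t, ht, rfl⟩; exact ⟨t, ht.1, rfl⟩))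
  · rintro _ ⟨s, hs, rfl⟩
    refine ⟨_, ⟨_, ⟨_, ⟨s, hs, rfl⟩, rfl⟩, rfl⟩, ε s, ?_⟩
    rw [LinearMap.id_apply, hπ s (hL s hs.1).2, smul_smul]
    simp [ε, ← mul_pow]

/-- Relabelling does not lower the rank of the boundary map. -/
theorem bdryRank_image_le {W : Type*} [LinearOrder W] (f : V → W) {K : Finset (Finset V)}
    (hf : ∀ s ∈ K, Set.InjOn f s) (c : ℕ) :
    bdryRank F (K.image (Finset.image f)) c ≤ bdryRank F K c := by
  classical
  -- inv counts the pairs whose order f reverses; ε is the sign of the permutation sorting the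
  -- image, which makes relabelling compatible with boundaries.
  let inv : Finset V → ℕ := fun s => ((s ×ˢ s).filter fun p => p.1 < p.2 ∧ f p.2 < f p.1).card
  let ε : Finset V → F := fun t => (-1) ^ inv t
  let π : (Finset V →₀ F) →ₗ[F] (Finset W →₀ F) :=
    Finsupp.linearCombination F fun t => Finsupp.single (t.image f) (ε t)
  have hinv : ∀ s : Finset V, Set.InjOn f s → ∀ v ∈ s,
      (-1 : F) ^ (s.filter fun w => w < v).card * ε (s.erase v) =
        ε s * (-1 : F) ^ ((s.image f).filter fun w => w < f v).card := by
    intro s hs v hv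
    have h1 : inv s = inv (s.erase v) + (s.filter fun w => w < v ∧ f v < f w).card
        + (s.filter fun w => v < w ∧ f w < f v).card := by
      have e1 : inv s = ∑ a ∈ s, ∑ b ∈ s, if a < b ∧ f b < f a then 1 else 0 := by
        simp only [inv, Finset.card_filter, Finset.sum_product]
      have e2 : inv (s.erase v) =
          ∑ a ∈ s.erase v, ∑ b ∈ s.erase v, if a < b ∧ f b < f a then 1 else 0 := by
        simp only [inv, Finset.card_filter, Finset.sum_product]
      rw [e1, e2, ← Finset.add_sum_erase s _ hv, Finset.card_filter, Finset.card_filter]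
      have e3 : ∀ a, (∑ b ∈ s, if a < b ∧ f b < f a then 1 else 0) =
          (if a < v ∧ f v < f a then 1 else 0) +
            ∑ b ∈ s.erase v, if a < b ∧ f b < f a then 1 else 0 :=
        fun a => (Finset.add_sum_erase s _ hv).symm
      rw [Finset.sum_congr rfl fun a _ => e3 a, Finset.sum_add_distrib]
      rw [← Finset.add_sum_erase s (fun w => if w < v ∧ f v < f w then 1 else 0) hv]
      simp only [lt_self_iff_false, false_and, if_false]
      ring
    have h2 : (s.filter fun w => w < v).card = (s.filter fun w => w < v ∧ f w < f v).card
        + (s.filter fun w => w < v ∧ f v < f w).card := by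
      rw [← Finset.card_union_of_disjoint, ← Finset.filter_or]
      · congr 1
        refine Finset.filter_congr fun w hw => ?_
        constructor
        · intro h
          rcases lt_trichotomy (f w) (f v) with h' | h' | h'
          · exact Or.inl ⟨h, h'⟩
          · exact absurd (hs hw hv h') h.ne
          · exact Or.inr ⟨h, h'⟩
        · rintro (h | h) <;> exact h.1
      · rw [Finset.disjoint_filter]
        rintro w _ h h'
        exact absurd h.2 h'.2.not_gt
    have h3 : ((s.image f).filter fun w => w < f v).card =
        (s.filter fun w => w < v ∧ f w < f v).card + (s.filter fun w => v < w ∧ f w < f v).card := by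
      rw [Finset.filter_image, Finset.card_image_of_injOn (hs.mono fun w hw => (Finset.mem_filter.1 hw).1),
        ← Finset.card_union_of_disjoint, ← Finset.filter_or]
      · congr 1
        refine Finset.filter_congr fun w hw => ?_
        constructor
        · intro h
          rcases lt_trichotomy w v with h' | h' | h'
          · exact Or.inl ⟨h', h⟩
          · exact absurd (h' ▸ h) (lt_irrefl _)
          · exact Or.inr ⟨h', h⟩
        · rintro (h | h) <;> exact h.2
      · rw [Finset.disjoint_filter]
        rintro w _ h h'
        exact absurd h.1 h'.1.not_gt
    simp only [ε, ← pow_add]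
    -- The two exponents differ by twice the number of w > v with f w < f v.
    refine neg_one_pow_congr ?_
    rw [h1, h2, h3]
    grind
  have hπ : ∀ s ∈ K, simplexBdry F (s.image f) = ε s • π (simplexBdry F s) := by
    intro s hs
    simp only [simplexBdry, map_sum, π, Finsupp.linearCombination_single, Finsupp.smul_single,
      smul_eq_mul, Finset.smul_sum]
    rw [Finset.sum_image (hf s hs)]
    refine Finset.sum_congr rfl fun v hv => ?_
    rw [hinv s (hf s hs) v hv, ← mul_assoc]
    have : (s.image f).erase (f v) = (s.erase v).image f := by
      ext w
      simp only [Finset.mem_erase, Finset.mem_image]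
      constructor
      · rintro ⟨h, u, hu, rfl⟩
        exact ⟨u, ⟨fun h' => h (by rw [h']), hu⟩, rfl⟩
      · rintro ⟨u, ⟨h, hu⟩, rfl⟩
        exact ⟨fun h' => h (hf s hs hu hv h'), u, hu, rfl⟩
    rw [this]
    simp [ε, ← mul_pow]
  refine finrank_span_le_of_map F π (finite_simplexBdry_image F K c) ?_
  rintro _ ⟨_, ⟨ht, hc⟩, rfl⟩
  obtain ⟨s, hs, rfl⟩ := Finset.mem_image.1 ht
  refine ⟨_, ⟨s, ⟨hs, ?_⟩, rfl⟩, ε s, hπ s hs⟩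
  rw [← hc, Finset.card_image_of_injOn (hf s hs)]

end Boundary

end FiniteComplex

/-! ### Beta weights and the Shapley value. -/

namespace FiniteComplex

/-- The weight `1 / ((n + 1) C(n, a))`, i.e. the integral of `x ^ a * (1 - x) ^ (n - a)` over
the unit interval. -/
def betaWeight (n a : ℕ) : ℚ := (a.factorial * (n - a).factorial : ℕ) / ((n + 1).factorial : ℚ)

theorem betaWeight_nonneg (n a : ℕ) : 0 ≤ betaWeight n a := by
  unfold betaWeight; positivity

theorem betaWeight_eq {n a : ℕ} (h : a ≤ n) :
    betaWeight n a = 1 / ((n + 1) * (n.choose a : ℚ)) := by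
  have h1 : (n.choose a : ℚ) * a.factorial * (n - a).factorial = n.factorial := by
    exact_mod_cast Nat.choose_mul_factorial_mul_factorial h
  have h2 : (n.choose a : ℚ) ≠ 0 := by exact_mod_cast (Nat.choose_pos h).ne'
  have h3 : ((n : ℚ) + 1) ≠ 0 := by positivity
  have h4 : (a.factorial : ℚ) ≠ 0 := by positivity
  have h5 : ((n - a).factorial : ℚ) ≠ 0 := by positivity
  rw [betaWeight, Nat.factorial_succ]
  push_cast
  rw [← h1]
  field_simp

/-- Under the integral this is (1 - x) + x = 1: a further element is either left out or put in. -/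
theorem betaWeight_succ_add {n a : ℕ} (h : a ≤ n) :
    betaWeight (n + 1) a + betaWeight (n + 1) (a + 1) = betaWeight n a := by
  have h5 : ((n + 1).factorial : ℚ) ≠ 0 := by positivity
  have e : (n + 1 - a).factorial = (n - a + 1) * (n - a).factorial := by
    rw [Nat.succ_sub h, Nat.factorial_succ]
  have hc : ((n - a : ℕ) : ℚ) = n - a := by push_cast [h]; ring
  rw [betaWeight, betaWeight, betaWeight, Nat.factorial_succ (n + 1), e, Nat.factorial_succ a,
    Nat.add_sub_add_right]
  push_cast
  rw [hc]
  field_simp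
  ring

section

variable {V : Type*}

/-- The weighted sum of a function over the subsets of `W`. -/
def betaSum (W : Finset V) (φ : Finset V → ℚ) : ℚ :=
  ∑ A ∈ W.powerset, betaWeight W.card A.card * φ A

theorem betaSum_le {W : Finset V} {φ ψ : Finset V → ℚ} (h : ∀ A ⊆ W, φ A ≤ ψ A) :
    betaSum W φ ≤ betaSum W ψ :=
  Finset.sum_le_sum fun A hA =>
    mul_le_mul_of_nonneg_left (h A (Finset.mem_powerset.1 hA)) (betaWeight_nonneg _ _)

theorem betaSum_congr {W : Finset V} {φ ψ : Finset V → ℚ} (h : ∀ A ⊆ W, φ A = ψ A) :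
    betaSum W φ = betaSum W ψ :=
  Finset.sum_congr rfl fun A hA => by rw [h A (Finset.mem_powerset.1 hA)]

theorem betaSum_add (W : Finset V) (φ ψ : Finset V → ℚ) :
    betaSum W (fun A => φ A + ψ A) = betaSum W φ + betaSum W ψ := by
  simp [betaSum, mul_add, Finset.sum_add_distrib]

theorem betaSum_const_mul (W : Finset V) (a : ℚ) (φ : Finset V → ℚ) :
    betaSum W (fun A => a * φ A) = a * betaSum W φ := by
  simp only [betaSum, Finset.mul_sum]
  exact Finset.sum_congr rfl fun _ _ => by ring

theorem betaSum_image {W : Type*} [DecidableEq W] {f : V → W} {U : Finset V}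
    (hf : Set.InjOn f U) (φ : Finset W → ℚ) :
    betaSum (U.image f) φ = betaSum U (fun A => φ (A.image f)) := by
  have hinj : Set.InjOn (Finset.image f) U.powerset := by
    intro A hA B hB h
    simp only [Finset.coe_powerset, Set.mem_preimage, Set.mem_powerset_iff,
      Finset.coe_subset] at hA hB
    ext v
    constructor
    · intro hv
      obtain ⟨u, hu, huv⟩ := Finset.mem_image.1 (h ▸ Finset.mem_image_of_mem f hv)
      exact hf (hB hu) (hA hv) huv ▸ hu
    · intro hv
      obtain ⟨u, hu, huv⟩ := Finset.mem_image.1 (h.symm ▸ Finset.mem_image_of_mem f hv)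
      exact hf (hA hu) (hB hv) huv ▸ hu
  have hp : (U.image f).powerset = U.powerset.image (Finset.image f) := by
    ext A
    simp only [Finset.mem_powerset, Finset.mem_image, Finset.subset_image_iff]
  rw [betaSum, hp, Finset.sum_image hinj, betaSum]
  refine Finset.sum_congr rfl fun A hA => ?_
  rw [Finset.card_image_of_injOn hf,
    Finset.card_image_of_injOn (hf.mono (by exact_mod_cast Finset.mem_powerset.1 hA))]

variable [DecidableEq V]

/-- Choose p uniformly in [0, 1] and put each element of W into A independently with probability p:
`betaSum` is the expectation, and A ∩ U has the law of a random subset drawn from U directly. -/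
theorem betaSum_inter {U W : Finset V} (h : U ⊆ W) (φ : Finset V → ℚ) :
    betaSum W (fun A => φ (A ∩ U)) = betaSum U φ := by
  suffices H : ∀ T, Disjoint T U → betaSum (T ∪ U) (fun A => φ (A ∩ U)) = betaSum U φ by
    have := H (W \ U) Finset.sdiff_disjoint
    rwa [Finset.sdiff_union_of_subset h] at this
  intro T
  induction T using Finset.induction_on with
  | empty =>
    intro _
    rw [Finset.empty_union]
    exact betaSum_congr fun A hA => by rw [Finset.inter_eq_left.2 hA]
  | insert x T hx ih =>
    intro hT
    rw [Finset.disjoint_insert_left] at hT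
    have hxW : x ∉ T ∪ U := by simp [hx, hT.1]
    rw [← ih hT.2, Finset.insert_union, betaSum, Finset.sum_powerset_insert hxW, betaSum,
      ← Finset.sum_add_distrib]
    refine Finset.sum_congr rfl fun A hA => ?_
    have hA' := Finset.mem_powerset.1 hA
    have hxA : x ∉ A := fun h => hxW (hA' h)
    rw [Finset.insert_inter_of_notMem hT.1, Finset.card_insert_of_notMem hxW,
      Finset.card_insert_of_notMem hxA, ← add_mul, betaWeight_succ_add (Finset.card_le_card hA')]

theorem betaSum_indicator {U W B : Finset V} (h : U ⊆ W) (hB : B ⊆ U) :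
    betaSum W (fun A => if A ∩ U = B then 1 else 0) = betaWeight U.card B.card := by
  rw [betaSum_inter h (fun A => if A = B then 1 else 0), betaSum]
  simp [hB]

/-- Efficiency of the Shapley value. -/
theorem sum_betaSum_erase (W : Finset V) (φ : Finset V → ℚ) :
    ∑ x ∈ W, betaSum (W.erase x) (fun A => φ (insert x A) - φ A) = φ W - φ ∅ := by
  rcases W.eq_empty_or_nonempty with rfl | hW
  · simp
  have hn : 0 < W.card := hW.card_pos
  have h1 : ∑ x ∈ W, ∑ A ∈ (W.erase x).powerset, betaWeight (W.card - 1) A.card * φ (insert x A)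
      = ∑ B ∈ W.powerset, B.card * (betaWeight (W.card - 1) (B.card - 1) * φ B) := by
    have : ∀ x ∈ W, ∑ A ∈ (W.erase x).powerset, betaWeight (W.card - 1) A.card * φ (insert x A)
        = ∑ B ∈ W.powerset with x ∈ B, betaWeight (W.card - 1) (B.card - 1) * φ B := by
      intro x hx
      refine Finset.sum_bij' (fun A _ => insert x A) (fun B _ => B.erase x) ?_ ?_ ?_ ?_ ?_
      · intro A hA
        have := Finset.mem_powerset.1 hA
        simp only [Finset.mem_filter, Finset.mem_powerset, Finset.mem_insert_self, and_true]
        exact Finset.insert_subset hx (this.trans (Finset.erase_subset _ _))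
      · intro B hB
        simp only [Finset.mem_filter, Finset.mem_powerset] at hB ⊢
        exact Finset.erase_subset_erase _ hB.1
      · intro A hA
        exact Finset.erase_insert fun h => by simpa using Finset.mem_powerset.1 hA h
      · intro B hB
        exact Finset.insert_erase (Finset.mem_filter.1 hB).2
      · intro A hA
        rw [Finset.card_insert_of_notMem fun h => by simpa using Finset.mem_powerset.1 hA h,
          Nat.add_sub_cancel]
    rw [Finset.sum_congr rfl this,
      Finset.sum_comm' (t' := W.powerset) (s' := fun B => B)]
    · simp
    · intro x B
      simp only [Finset.mem_filter, Finset.mem_powerset]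
      exact ⟨fun h => ⟨h.2.2, h.2.1⟩, fun h => ⟨h.2 h.1, h.2, h.1⟩⟩
  have h2 : ∑ x ∈ W, ∑ A ∈ (W.erase x).powerset, betaWeight (W.card - 1) A.card * φ A
      = ∑ B ∈ W.powerset, (W.card - B.card : ℕ) * (betaWeight (W.card - 1) B.card * φ B) := by
    rw [Finset.sum_comm' (t' := W.powerset) (s' := fun B => W \ B)]
    · refine Finset.sum_congr rfl fun B hB => ?_
      rw [Finset.sum_const, Finset.card_sdiff_of_subset (Finset.mem_powerset.1 hB), nsmul_eq_mul]
    · intro x B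
      simp only [Finset.mem_powerset, Finset.mem_sdiff, Finset.subset_erase]
      tauto
  have h3 : ∑ x ∈ W, betaSum (W.erase x) (fun A => φ (insert x A) - φ A)
      = ∑ B ∈ W.powerset, (B.card * betaWeight (W.card - 1) (B.card - 1)
          - (W.card - B.card : ℕ) * betaWeight (W.card - 1) B.card) * φ B := by
    simp only [sub_mul, Finset.sum_sub_distrib, mul_assoc]
    rw [← h1, ← h2, ← Finset.sum_sub_distrib]
    refine Finset.sum_congr rfl fun x hx => ?_
    rw [betaSum, Finset.card_erase_of_mem hx, ← Finset.sum_sub_distrib]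
    exact Finset.sum_congr rfl fun A _ => by ring
  rw [h3]
  -- Both terms of the coefficient of φ B equal |B|! (|W| - |B|)! / |W|!, except that the first
  -- vanishes at B = ∅ and the second at B = W.
  have h4 : ∀ B ∈ W.powerset, (B.card * betaWeight (W.card - 1) (B.card - 1)
      - (W.card - B.card : ℕ) * betaWeight (W.card - 1) B.card) * φ B
      = (if B = W then φ B else 0) - (if B = ∅ then φ B else 0) := by
    intro B hB
    have hBW := Finset.mem_powerset.1 hB
    obtain ⟨n, hn⟩ : ∃ n, W.card = n + 1 := ⟨W.card - 1, by omega⟩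
    have hf : ((n + 1).factorial : ℚ) ≠ 0 := by positivity
    have t1 : (B.card * betaWeight n (B.card - 1) : ℚ) = if B = ∅ then 0 else
        (B.card.factorial * (n + 1 - B.card).factorial : ℚ) / (n + 1).factorial := by
      split_ifs with h
      · simp [h]
      · obtain ⟨b, hb⟩ : ∃ b, B.card = b + 1 :=
          ⟨B.card - 1, by have := Finset.card_pos.2 (Finset.nonempty_iff_ne_empty.2 h); omega⟩
        rw [hb, betaWeight, Nat.factorial_succ b]
        simp only [Nat.add_sub_add_right, Nat.add_sub_cancel]
        push_cast
        ring
    have t2 : ((n + 1 - B.card : ℕ) * betaWeight n B.card : ℚ) = if B = W then 0 else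
        (B.card.factorial * (n + 1 - B.card).factorial : ℚ) / (n + 1).factorial := by
      split_ifs with h
      · simp [h, hn]
      · have hlt : B.card < n + 1 := hn ▸ Finset.card_lt_card (lt_of_le_of_ne hBW h)
        obtain ⟨b, hb⟩ : ∃ b, n = B.card + b := ⟨n - B.card, by omega⟩
        have e1 : n + 1 - B.card = b + 1 := by omega
        have e2 : n - B.card = b := by omega
        rw [betaWeight, e1, e2, Nat.factorial_succ b]
        push_cast
        ring
    rw [hn, Nat.add_sub_cancel, t1, t2]
    by_cases hB0 : B = ∅
    · subst hB0
      have : ∅ ≠ W := hW.ne_empty.symm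
      simp [this, hf]
    · by_cases hB1 : B = W
      · subst hB1
        simp [hB0, hn, hf]
      · simp [hB0, hB1]
  rw [Finset.sum_congr rfl h4, Finset.sum_sub_distrib]
  simp

end

end FiniteComplex

/-! ### Alternating sums, g-numbers and truncated Euler characteristics. -/

namespace FiniteComplex

/-- The alternating sum `f m - f (m - 1) + ...`. -/
def altSum (f : ℕ → ℚ) (m : ℕ) : ℚ := ∑ j ∈ Finset.range (m + 1), (-1) ^ (m - j) * f j

theorem altSum_zero (f : ℕ → ℚ) : altSum f 0 = f 0 := by simp [altSum]

theorem altSum_succ (f : ℕ → ℚ) (m : ℕ) : altSum f (m + 1) = f (m + 1) - altSum f m := by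
  rw [altSum, Finset.sum_range_succ, altSum, Nat.sub_self, pow_zero, one_mul, add_comm,
    sub_eq_add_neg, ← Finset.sum_neg_distrib]
  congr 1
  refine Finset.sum_congr rfl fun j hj => ?_
  rw [Nat.succ_sub (Nat.lt_succ_iff.1 (Finset.mem_range.1 hj)), pow_succ]
  ring

theorem altSum_add (f g : ℕ → ℚ) (m : ℕ) :
    altSum (fun j => f j + g j) m = altSum f m + altSum g m := by
  simp [altSum, mul_add, Finset.sum_add_distrib]

theorem altSum_congr {f g : ℕ → ℚ} {m : ℕ} (h : ∀ j ≤ m, f j = g j) :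
    altSum f m = altSum g m :=
  Finset.sum_congr rfl fun j hj => by rw [h j (Nat.lt_succ_iff.1 (Finset.mem_range.1 hj))]

theorem altSum_shift (f : ℕ → ℚ) (b m : ℕ) :
    altSum (fun j => if b ≤ j then f (j - b) else 0) m = if b ≤ m then altSum f (m - b) else 0 := by
  induction m with
  | zero =>
    rw [altSum_zero]
    simp only [Nat.zero_sub, altSum_zero]
  | succ m ih =>
    rw [altSum_succ, ih]
    rcases lt_trichotomy b (m + 1) with h | h | h
    · rw [if_pos h.le, if_pos (Nat.lt_succ_iff.1 h), Nat.succ_sub (Nat.lt_succ_iff.1 h),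
        altSum_succ, if_pos h.le]
    · subst h
      simp [altSum_zero]
    · rw [if_neg h.not_ge, if_neg (by omega), if_neg h.not_ge, sub_zero]

theorem altSum_single (b m : ℕ) (q : ℚ) :
    altSum (fun j => if j = b then q else 0) m = if b ≤ m then (-1) ^ (m - b) * q else 0 := by
  simp [altSum]

theorem altSum_choose_succ (n m : ℕ) :
    altSum (fun j => ((n + 1).choose j : ℚ)) m = n.choose m := by
  induction m with
  | zero => simp [altSum_zero]
  | succ m ih => rw [altSum_succ, ih, Nat.choose_succ_succ]; push_cast; ring

theorem altSum_choose_zero (m : ℕ) : altSum (fun j => (Nat.choose 0 j : ℚ)) m = (-1) ^ m := by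
  induction m with
  | zero => simp [altSum_zero]
  | succ m ih => rw [altSum_succ, ih]; simp [pow_succ]

/-- Binomial inversion: C(E - b, c - b) faces of each size c contribute to g only in degree b. These
are the faces gained by a move with |β| = b and |α| = E - b; b = 0 is the simplex. -/
theorem altSum_mul_choose (E b j : ℕ) :
    altSum (fun c => ((E - c).choose (j - c) : ℚ) * if b ≤ c then ((E - b).choose (c - b) : ℚ) else 0) j
      = if j = b then 1 else 0 := by
  rcases lt_or_ge j b with h | h
  · rw [if_neg h.ne]
    refine Finset.sum_eq_zero fun c hc => ?_
    dsimp only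
    rw [if_neg (by have := Finset.mem_range.1 hc; omega), mul_zero, mul_zero]
  · have h1 : altSum (fun c => ((E - c).choose (j - c) : ℚ) *
        if b ≤ c then ((E - b).choose (c - b) : ℚ) else 0) j
        = altSum (fun c => if b ≤ c then
          (fun i => ((E - b).choose (j - b) : ℚ) * ((j - b).choose i : ℚ)) (c - b) else 0) j := by
      refine altSum_congr fun c hc => ?_
      split_ifs with hbc
      · have := Nat.choose_mul (n := E - b) (k := j - b) (s := c - b) (by omega)
        have e1 : E - b - (c - b) = E - c := by omega
        have e2 : j - b - (c - b) = j - c := by omega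
        rw [e1, e2] at this
        dsimp only
        exact_mod_cast (by rw [this]; ring)
      · simp
    rw [h1, altSum_shift (fun i => ((E - b).choose (j - b) : ℚ) * ((j - b).choose i : ℚ)), if_pos h]
    have h2 : altSum (fun i => ((E - b).choose (j - b) : ℚ) * ((j - b).choose i : ℚ)) (j - b)
        = ((E - b).choose (j - b) : ℚ) * altSum (fun i => ((j - b).choose i : ℚ)) (j - b) := by
      simp only [altSum, Finset.mul_sum]
      exact Finset.sum_congr rfl fun _ _ => by ring
    rw [h2]
    rcases h.eq_or_lt with rfl | h'
    · simp [altSum_zero]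
    · obtain ⟨n, hn⟩ : ∃ n, j - b = n + 1 := ⟨j - b - 1, by omega⟩
      rw [if_neg h'.ne', hn, altSum_choose_succ]
      simp

section

variable {V : Type*}

/-- The number of members of `K` with `c` elements. -/
def faceCount (K : Finset (Finset V)) (c : ℕ) : ℚ := (K.filter (fun s => s.card = c)).card

/-- The `g`-number of a family of faces, where `E` is the number of vertices of the boundary of a
simplex of the relevant dimension. -/
def gNum (K : Finset (Finset V)) (E j : ℕ) : ℚ :=
  altSum (fun c => ((E - c).choose (j - c) : ℚ) * faceCount K c) j

/-- The members of `K` contained in `A`. -/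
def restrict [DecidableEq V] (K : Finset (Finset V)) (A : Finset V) : Finset (Finset V) :=
  K.filter (fun s => s ⊆ A)

/-- The union of all faces. -/
def support [DecidableEq V] (X : FiniteComplex V) : Finset V := X.faces.sup id

theorem subset_support [DecidableEq V] (X : FiniteComplex V) {s : Finset V} (hs : s ∈ X.faces) :
    s ⊆ X.support := Finset.le_sup (f := id) hs

theorem mem_support [DecidableEq V] (X : FiniteComplex V) {v : V} :
    v ∈ X.support ↔ X.IsVertex v := by
  constructor
  · intro h
    obtain ⟨s, hs, hv⟩ := Finset.mem_sup.1 h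
    exact X.down_closed s hs _ (Finset.singleton_subset_iff.2 hv)
  · intro h
    exact X.subset_support h (Finset.mem_singleton_self v)

theorem restrict_support [DecidableEq V] (X : FiniteComplex V) {A U : Finset V}
    (hU : X.support ⊆ U) : restrict X.faces (A ∩ U) = restrict X.faces A := by
  refine Finset.filter_congr fun s hs => ?_
  rw [Finset.subset_inter_iff, and_iff_left ((X.subset_support hs).trans hU)]

variable [LinearOrder V] (F : Type*) [Field F]

/-- The alternating sum of the reduced Betti numbers of `K` in dimensions less than `c`. -/
noncomputable def truncEuler (K : Finset (Finset V)) (c : ℕ) : ℚ :=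
  altSum (faceCount K) c - bdryRank F K (c + 1)

/-- The weighted sum of the truncated Euler characteristics of the induced subcomplexes. -/
noncomputable def inducedEuler (X : FiniteComplex V) (c : ℕ) : ℚ :=
  betaSum X.support (fun A => truncEuler F (restrict X.faces A) c)

theorem inducedEuler_eq (X : FiniteComplex V) {W : Finset V} (hW : X.support ⊆ W) (c : ℕ) :
    X.inducedEuler F c = betaSum W (fun A => truncEuler F (restrict X.faces A) c) := by
  rw [inducedEuler, ← betaSum_inter hW]
  exact betaSum_congr fun A _ => by rw [X.restrict_support le_rfl]

/-- If A has an element a, the alternating count of the new faces is C(|A| - 1, c - |β|), and the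
cones with apex a over the faces β ∪ ρ, a ∉ ρ, yield at least that much new rank. Only for A = ∅,
when β alone is new, does a term remain. -/
theorem truncEuler_add_join_le {K K' : Finset (Finset V)} {β A : Finset V} {c : ℕ}
    (hβA : Disjoint β A)
    (hcount : ∀ j ≤ c, faceCount K' j =
      faceCount K j + if β.card ≤ j then (A.card.choose (j - β.card) : ℚ) else 0)
    (hK : ∀ s ∈ K, s.card = c + 1 → s ∈ K')
    (hK' : ∀ σ ⊆ A, β.card + σ.card = c + 1 → β ∪ σ ∈ K')
    (hβK : ∀ s ∈ K, ¬ β ⊆ s) :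
    truncEuler F K' c ≤
      truncEuler F K c + if A = ∅ ∧ β.card ≤ c then (-1) ^ (c - β.card) else 0 := by
  have hr : (bdryRank F K (c + 1) : ℚ) ≤ bdryRank F K' (c + 1) := by
    exact_mod_cast bdryRank_mono F hK
  rw [truncEuler, truncEuler, altSum_congr hcount, altSum_add,
    altSum_shift (fun i => (A.card.choose i : ℚ))]
  by_cases hb : β.card ≤ c
  swap
  · simp only [hb, and_false, if_false]
    linarith
  rw [if_pos hb]
  rcases A.eq_empty_or_nonempty with rfl | ⟨a, ha⟩
  · rw [if_pos ⟨rfl, hb⟩, Finset.card_empty, altSum_choose_zero]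
    linarith
  rw [if_neg (fun h => Finset.ne_empty_of_mem ha h.1)]
  have hA : A.card = (A.erase a).card + 1 := (Finset.card_erase_add_one ha).symm
  rw [hA, altSum_choose_succ]
  have haβ : a ∉ β := fun h => Finset.disjoint_left.1 hβA h ha
  have hmem : ∀ ρ ∈ (A.erase a).powersetCard (c - β.card), ρ ⊆ A ∧ a ∉ ρ ∧ Disjoint β ρ ∧
      ρ.card = c - β.card := by
    intro ρ hρ
    rw [Finset.mem_powersetCard, Finset.subset_erase] at hρ
    exact ⟨hρ.1.1, hρ.1.2, hβA.mono_right hρ.1.1, hρ.2⟩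
  have key := bdryRank_add_card_le F (K := K) (K' := K')
    (N := ((A.erase a).powersetCard (c - β.card)).image (fun ρ => β ∪ ρ)) (c := c) a hK
    (by
      intro s hs
      obtain ⟨ρ, hρ, rfl⟩ := Finset.mem_image.1 hs
      obtain ⟨h1, h2, h3, h4⟩ := hmem ρ hρ
      refine ⟨by simp [haβ, h2], ?_, ?_⟩
      · rw [Finset.card_union_of_disjoint h3]; omega
      · rw [← Finset.union_insert]
        refine hK' _ (Finset.insert_subset ha h1) ?_
        rw [Finset.card_insert_of_notMem h2]; omega)
    (by
      intro s hs _ t ht hts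
      obtain ⟨ρ, hρ, rfl⟩ := Finset.mem_image.1 ht
      exact hβK s hs (Finset.subset_union_left.trans hts))
  rw [Finset.card_image_of_injOn, Finset.card_powersetCard] at key
  · have : (bdryRank F K (c + 1) : ℚ) + ((A.erase a).card.choose (c - β.card) : ℕ)
        ≤ bdryRank F K' (c + 1) := by exact_mod_cast key
    linarith
  · intro ρ hρ τ hτ h
    have h1 := (hmem ρ hρ).2.2.1
    have h2 := (hmem τ hτ).2.2.1
    have := congrArg (fun s => s \ β) h
    simpa [Finset.union_sdiff_cancel_left h1, Finset.union_sdiff_cancel_left h2] using this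

end

end FiniteComplex

/-! ### The effect of bistellar moves. -/

namespace FiniteComplex

section

variable {V : Type*} [DecidableEq V] {X Y : FiniteComplex V} {α β : Finset V}

theorem mem_joinFaces {A B : Finset (Finset V)} {s : Finset V} :
    s ∈ joinFaces A B ↔ ∃ u ∈ A, ∃ v ∈ B, u ∪ v = s := by
  simp [joinFaces, Finset.mem_image₂]

namespace IsBistellarMove

theorem not_subset (h : IsBistellarMove X Y α β) {s : Finset V} (hs : s ∈ X.faces) : ¬ β ⊆ s := by
  intro hβ
  have h1 : β ∈ X.faces.filter (fun s => s ⊆ α ∪ β) :=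
    Finset.mem_filter.2 ⟨X.down_closed s hs β hβ, Finset.subset_union_right⟩
  rw [h.induced, mem_joinFaces] at h1
  obtain ⟨u, hu, v, hv, huv⟩ := h1
  rw [Finset.mem_powerset] at hu
  rw [Finset.mem_ssubsets] at hv
  refine hv.2 fun b hb => ?_
  have hb' : b ∈ u ∪ v := huv.symm ▸ hb
  exact (Finset.mem_union.1 hb').resolve_left
    fun hbu => Finset.disjoint_left.1 h.disjoint (hu hbu) hb

/-- Every face lost in the move contains α, so below size |α| the move only adds faces. -/
theorem mem_faces_iff (h : IsBistellarMove X Y α β) {s : Finset V} (hs : s.card < α.card) :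
    s ∈ Y.faces ↔ s ∈ X.faces ∨ (β ⊆ s ∧ s ⊆ α ∪ β) := by
  have hlt : ∀ u ⊆ α, u ⊆ s → u ∈ α.ssubsets := fun u hu hus => by
    refine Finset.mem_ssubsets.2 (Finset.ssubset_iff_subset_ne.2 ⟨hu, ?_⟩)
    rintro rfl
    exact absurd (Finset.card_le_card hus) hs.not_ge
  rw [h.faces_eq, Finset.mem_union, Finset.mem_sdiff]
  constructor
  · rintro (h1 | h1)
    · exact Or.inl h1.1
    · obtain ⟨u, hu, v, hv, rfl⟩ := mem_joinFaces.1 h1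
      rw [Finset.mem_ssubsets] at hu
      rw [Finset.mem_powerset] at hv
      by_cases hvβ : v = β
      · subst hvβ
        exact Or.inr ⟨Finset.subset_union_right, Finset.union_subset_union_left hu.1⟩
      · have h2 : u ∪ v ∈ joinFaces α.powerset β.ssubsets :=
          mem_joinFaces.2 ⟨u, Finset.mem_powerset.2 hu.1, v,
            Finset.mem_ssubsets.2 (Finset.ssubset_iff_subset_ne.2 ⟨hv, hvβ⟩), rfl⟩
        rw [← h.induced] at h2
        exact Or.inl (Finset.mem_filter.1 h2).1
  · rintro (h1 | ⟨h1, h2⟩)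
    · by_cases h3 : s ∈ joinFaces α.powerset β.ssubsets
      · obtain ⟨u, hu, v, hv, rfl⟩ := mem_joinFaces.1 h3
        exact Or.inr (mem_joinFaces.2 ⟨u, hlt u (Finset.mem_powerset.1 hu)
          Finset.subset_union_left, v, Finset.mem_powerset.2 (Finset.mem_ssubsets.1 hv).1, rfl⟩)
      · exact Or.inl ⟨h1, h3⟩
    · refine Or.inr (mem_joinFaces.2 ⟨s ∩ α, hlt _ Finset.inter_subset_right
        Finset.inter_subset_left, β, Finset.mem_powerset_self _, ?_⟩)
      ext v
      have e1 := @h1 v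
      have e2 := @h2 v
      simp only [Finset.mem_union, Finset.mem_inter] at e2 ⊢
      tauto

theorem card_add_card (h : IsBistellarMove X Y α β) {E : ℕ} (hE : X.dim = (E : ℤ) - 2) :
    α.card + β.card = E := by
  have := h.dim_eq
  omega

theorem card_union (h : IsBistellarMove X Y α β) : (α ∪ β).card = α.card + β.card :=
  Finset.card_union_of_disjoint h.disjoint

theorem dim_eq_dim (h : IsBistellarMove X Y α β) : Y.dim = X.dim := by
  have hd := h.dim_eq
  have hα := h.nonempty_left.card_pos
  have hβ := h.nonempty_right.card_pos
  unfold dim at hd ⊢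
  have h1 : Y.faces.sup Finset.card ≤ X.faces.sup Finset.card := by
    refine Finset.sup_le fun s hs => ?_
    rw [h.faces_eq, Finset.mem_union, Finset.mem_sdiff] at hs
    rcases hs with hs | hs
    · exact Finset.le_sup hs.1
    · obtain ⟨u, hu, v, hv, rfl⟩ := mem_joinFaces.1 hs
      have e1 := Finset.card_lt_card (Finset.mem_ssubsets.1 hu)
      have e2 := Finset.card_le_card (Finset.mem_powerset.1 hv)
      have e3 := Finset.card_union_le u v
      omega
  have h2 : X.faces.sup Finset.card ≤ Y.faces.sup Finset.card := by
    obtain ⟨a, ha⟩ := h.nonempty_left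
    have hmem : α.erase a ∪ β ∈ Y.faces := by
      rw [h.faces_eq, Finset.mem_union]
      exact Or.inr (mem_joinFaces.2 ⟨_, Finset.mem_ssubsets.2 (Finset.erase_ssubset ha), _,
        Finset.mem_powerset_self _, rfl⟩)
    have e1 := Finset.le_sup (f := Finset.card) hmem
    have e2 : (α.erase a ∪ β).card = α.card - 1 + β.card := by
      rw [Finset.card_union_of_disjoint (h.disjoint.mono_left (Finset.erase_subset _ _)),
        Finset.card_erase_of_mem ha]
    omega
  omega

theorem faceCount_restrict (h : IsBistellarMove X Y α β) (A : Finset V) {j : ℕ}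
    (hj : j < α.card) (hβ : β ⊆ A) :
    faceCount (restrict Y.faces A) j = faceCount (restrict X.faces A) j +
      if β.card ≤ j then ((A ∩ α).card.choose (j - β.card) : ℚ) else 0 := by
  have hset : (restrict Y.faces A).filter (fun s => s.card = j) =
      (restrict X.faces A).filter (fun s => s.card = j) ∪
        if β.card ≤ j then ((A ∩ α).powersetCard (j - β.card)).image (fun σ => β ∪ σ) else ∅ := by
    ext s
    simp only [restrict, Finset.mem_union, Finset.mem_filter]
    constructor
    · rintro ⟨⟨h1, h2⟩, h3⟩
      rcases (h.mem_faces_iff (h3 ▸ hj)).1 h1 with h4 | ⟨h4, h5⟩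
      · exact Or.inl ⟨⟨h4, h2⟩, h3⟩
      · have hle := Finset.card_le_card h4
        rw [if_pos (h3 ▸ hle), Finset.mem_image]
        refine Or.inr ⟨s \ β, Finset.mem_powersetCard.2 ⟨fun v hv => ?_, ?_⟩,
          Finset.union_sdiff_of_subset h4⟩
        · obtain ⟨hv1, hv2⟩ := Finset.mem_sdiff.1 hv
          exact Finset.mem_inter.2 ⟨h2 hv1, (Finset.mem_union.1 (h5 hv1)).resolve_right hv2⟩
        · rw [Finset.card_sdiff_of_subset h4, h3]
    · rintro (⟨⟨h1, h2⟩, h3⟩ | h1)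
      · exact ⟨⟨(h.mem_faces_iff (h3 ▸ hj)).2 (Or.inl h1), h2⟩, h3⟩
      · split_ifs at h1 with hle
        · obtain ⟨σ, hσ, rfl⟩ := Finset.mem_image.1 h1
          obtain ⟨h2, h3⟩ := Finset.mem_powersetCard.1 hσ
          have h4 : (β ∪ σ).card = j := by
            rw [Finset.card_union_of_disjoint
              (h.disjoint.symm.mono_right (h2.trans Finset.inter_subset_right)), h3]
            omega
          refine ⟨⟨(h.mem_faces_iff (h4 ▸ hj)).2 (Or.inr ⟨Finset.subset_union_left, ?_⟩), ?_⟩, h4⟩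
          · exact Finset.union_subset Finset.subset_union_right
              ((h2.trans Finset.inter_subset_right).trans Finset.subset_union_left)
          · exact Finset.union_subset hβ (h2.trans Finset.inter_subset_left)
        · simp at h1
  rw [faceCount, hset, Finset.card_union_of_disjoint, faceCount, Nat.cast_add]
  · congr 1
    split_ifs with hle
    · rw [Finset.card_image_of_injOn, Finset.card_powersetCard]
      intro ρ hρ τ hτ e
      have h1 := h.disjoint.symm.mono_right
        ((Finset.mem_powersetCard.1 hρ).1.trans Finset.inter_subset_right)
      have h2 := h.disjoint.symm.mono_right
        ((Finset.mem_powersetCard.1 hτ).1.trans Finset.inter_subset_right)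
      have := congrArg (fun s => s \ β) e
      simpa [Finset.union_sdiff_cancel_left h1, Finset.union_sdiff_cancel_left h2] using this
    · simp
  · rw [Finset.disjoint_left]
    intro s hs hs'
    split_ifs at hs' with hle
    · obtain ⟨σ, -, rfl⟩ := Finset.mem_image.1 hs'
      exact h.not_subset (Finset.mem_filter.1 (Finset.mem_filter.1 hs).1).1
        Finset.subset_union_left
    · simp at hs'

theorem faceCount_faces (h : IsBistellarMove X Y α β) {j : ℕ} (hj : j < α.card) :
    faceCount Y.faces j = faceCount X.faces j +
      if β.card ≤ j then (α.card.choose (j - β.card) : ℚ) else 0 := by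
  have hres : ∀ Z : FiniteComplex V, Z.support ⊆ X.support ∪ Y.support ∪ α ∪ β →
      restrict Z.faces (X.support ∪ Y.support ∪ α ∪ β) = Z.faces := fun Z hZ =>
    Finset.filter_true_of_mem fun s hs => (Z.subset_support hs).trans hZ
  have := h.faceCount_restrict (X.support ∪ Y.support ∪ α ∪ β) hj Finset.subset_union_right
  rwa [hres X (by intro v; simp +contextual), hres Y (by intro v; simp +contextual),
    Finset.inter_eq_right.2 (by intro v; simp +contextual)] at this

theorem gNum_eq (h : IsBistellarMove X Y α β) {j : ℕ} (hj : j < α.card) :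
    gNum Y.faces (α.card + β.card) j =
      gNum X.faces (α.card + β.card) j + if j = β.card then 1 else 0 := by
  rw [← altSum_mul_choose (α.card + β.card) β.card j, gNum, gNum, ← altSum_add]
  refine altSum_congr fun c hc => ?_
  rw [h.faceCount_faces (hc.trans_lt hj), Nat.add_sub_cancel, mul_add]

end IsBistellarMove

end

section

variable {V : Type*} [LinearOrder V] (F : Type*) [Field F]

theorem truncEuler_congr {K K' : Finset (Finset V)} {c : ℕ}
    (h : ∀ s, s.card ≤ c + 1 → (s ∈ K ↔ s ∈ K')) : truncEuler F K c = truncEuler F K' c := by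
  rw [truncEuler, truncEuler, bdryRank, bdryRank]
  congr 1
  · refine altSum_congr fun j hj => ?_
    rw [faceCount, faceCount]
    congr 2
    ext s
    simp only [Finset.mem_filter]
    exact and_congr_left fun hs => h s (by omega)
  · have : {s | s ∈ K ∧ s.card = c + 1} = {s | s ∈ K' ∧ s.card = c + 1} := by
      ext s
      exact and_congr_left fun hs => h s hs.le
    rw [this]

theorem truncEuler_empty (c : ℕ) : truncEuler F (∅ : Finset (Finset V)) c = 0 := by
  have h : simplexBdry F '' {s : Finset V | s ∈ (∅ : Finset (Finset V)) ∧ s.card = c + 1} = ∅ := by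
    simp
  rw [truncEuler, bdryRank, h, Submodule.span_empty, finrank_bot]
  simp [altSum, faceCount]

/-- `truncEuler` at c sees only faces with at most c + 1 < |α| elements. Among these, A gains the
sets β ∪ σ with σ ⊆ A ∩ α if β ⊆ A, and none otherwise. -/
theorem IsBistellarMove.truncEuler_le {X Y : FiniteComplex V} {α β : Finset V}
    (h : IsBistellarMove X Y α β) (A : Finset V) {c : ℕ} (hc : c + 1 < α.card) :
    truncEuler F (restrict Y.faces A) c ≤ truncEuler F (restrict X.faces A) c +
      (if β.card ≤ c then (-1) ^ (c - β.card) else 0) *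
        if A ∩ (α ∪ β) = β then 1 else 0 := by
  by_cases hβ : β ⊆ A
  · have hiff : A ∩ (α ∪ β) = β ↔ A ∩ α = ∅ := by
      rw [Finset.inter_union_distrib_left, Finset.inter_eq_right.2 hβ, Finset.union_eq_right]
      constructor
      · intro h1
        exact Finset.disjoint_self_iff_empty _ |>.1
          (h.disjoint.mono Finset.inter_subset_right h1)
      · intro h1
        rw [h1]
        exact Finset.empty_subset _
    have key := truncEuler_add_join_le F (K := restrict X.faces A) (K' := restrict Y.faces A)
      (β := β) (A := A ∩ α) (c := c) (h.disjoint.symm.mono_right Finset.inter_subset_right)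
      (fun j hj => h.faceCount_restrict A (by omega) hβ)
      (by
        intro s hs hsc
        obtain ⟨h1, h2⟩ := Finset.mem_filter.1 hs
        exact Finset.mem_filter.2 ⟨(h.mem_faces_iff (by omega)).2 (Or.inl h1), h2⟩)
      (by
        intro σ hσ hcard
        have h1 : (β ∪ σ).card = c + 1 := by
          rw [Finset.card_union_of_disjoint
            (h.disjoint.symm.mono_right (hσ.trans Finset.inter_subset_right)), hcard]
        refine Finset.mem_filter.2 ⟨(h.mem_faces_iff (by omega)).2
          (Or.inr ⟨Finset.subset_union_left, ?_⟩), ?_⟩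
        · exact Finset.union_subset Finset.subset_union_right
            ((hσ.trans Finset.inter_subset_right).trans Finset.subset_union_left)
        · exact Finset.union_subset hβ (hσ.trans Finset.inter_subset_left))
      (fun s hs => h.not_subset (Finset.mem_filter.1 hs).1)
    refine key.trans (le_of_eq ?_)
    simp only [hiff]
    congr 1
    by_cases h1 : A ∩ α = ∅ <;> by_cases h2 : β.card ≤ c <;> simp [h1, h2]
  · rw [if_neg fun h1 : A ∩ (α ∪ β) = β => hβ (h1 ▸ Finset.inter_subset_left), mul_zero,
      add_zero]
    refine (truncEuler_congr F fun s hs => ?_).le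
    simp only [restrict, Finset.mem_filter]
    refine and_congr_left fun h1 => ?_
    rw [h.mem_faces_iff (by omega), or_iff_left]
    exact fun h2 => hβ (h2.1.trans h1)

/-- The estimate for the weighted Euler characteristics and the `g`-numbers of `X`, a complex of
the same dimension as the boundary of a simplex with `E` vertices. -/
structure HasStellatedBounds (k E : ℕ) (X : FiniteComplex V) : Prop where
  dim_eq : X.dim = (E : ℤ) - 2
  inducedEuler_le : ∀ c, c + k + 2 ≤ E →
    X.inducedEuler F c ≤ 1 / (E + 1) * altSum (fun j => gNum X.faces E j / E.choose j) c
  gNum_eq_zero : ∀ j, k < j → j + k + 2 ≤ E → gNum X.faces E j = 0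

theorem faceCount_restrict_simplexBoundary {α : Finset V} (hα : α.Nonempty) (A : Finset V) {j : ℕ}
    (hj : j < α.card) :
    faceCount (restrict (simplexBoundary α hα).faces A) j = ((A ∩ α).card.choose j : ℚ) := by
  rw [faceCount, ← Finset.card_powersetCard]
  congr 2
  ext s
  simp only [restrict, simplexBoundary, Finset.mem_filter, Finset.mem_ssubsets,
    Finset.mem_powersetCard, Finset.subset_inter_iff]
  constructor
  · rintro ⟨⟨h1, h2⟩, h3⟩
    exact ⟨⟨h2, h1.1⟩, h3⟩
  · rintro ⟨⟨h1, h2⟩, h3⟩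
    refine ⟨⟨Finset.ssubset_iff_subset_ne.2 ⟨h2, ?_⟩, h1⟩, h3⟩
    rintro rfl
    omega

theorem gNum_simplexBoundary {α : Finset V} (hα : α.Nonempty) {j : ℕ} (hj : j < α.card) :
    gNum (simplexBoundary α hα).faces α.card j = if j = 0 then 1 else 0 := by
  have hres : restrict (simplexBoundary α hα).faces α = (simplexBoundary α hα).faces :=
    Finset.filter_true_of_mem fun s hs => (Finset.mem_ssubsets.1 hs).1
  rw [← altSum_mul_choose α.card 0 j, gNum]
  refine altSum_congr fun c hc => ?_
  rw [← hres, faceCount_restrict_simplexBoundary hα α (hc.trans_lt hj)]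
  simp

theorem hasStellatedBounds_simplexBoundary (k : ℕ) {α : Finset V} (hα : α.Nonempty) :
    HasStellatedBounds F k α.card (simplexBoundary α hα) := by
  have hpos := hα.card_pos
  refine ⟨?_, ?_, ?_⟩
  · have h1 : (simplexBoundary α hα).faces.sup Finset.card ≤ α.card - 1 :=
      Finset.sup_le fun s hs => by
        have := Finset.card_lt_card (Finset.mem_ssubsets.1 hs)
        omega
    obtain ⟨a, ha⟩ := hα
    have h2 := Finset.le_sup (f := Finset.card) (s := (simplexBoundary α ⟨a, ha⟩).faces)
      (Finset.mem_ssubsets.2 (Finset.erase_ssubset ha))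
    rw [Finset.card_erase_of_mem ha] at h2
    unfold dim
    omega
  · intro c hc
    have hsup : (simplexBoundary α hα).support ⊆ α :=
      Finset.sup_le fun s hs => (Finset.mem_ssubsets.1 hs).1
    have hle : ∀ A ⊆ α, truncEuler F (restrict (simplexBoundary α hα).faces A) c ≤
        (-1) ^ c * if A ∩ α = ∅ then 1 else 0 := by
      intro A hA
      -- The initial sphere is treated like a move with β = ∅ applied to the empty family; sizes up
      -- to c + 1 do not reach the missing face α.
      have key := truncEuler_add_join_le F (K := ∅)
        (K' := restrict (simplexBoundary α hα).faces A) (β := ∅) (A := A ∩ α) (c := c)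
        (Finset.disjoint_empty_left _)
        (fun j hj => by
          rw [faceCount_restrict_simplexBoundary hα A (by omega)]; simp [faceCount])
        (by simp)
        (by
          intro σ hσ hcard
          rw [Finset.card_empty, zero_add] at hcard
          rw [Finset.empty_union]
          refine Finset.mem_filter.2 ⟨Finset.mem_ssubsets.2 (Finset.ssubset_iff_subset_ne.2
            ⟨hσ.trans Finset.inter_subset_right, ?_⟩), hσ.trans Finset.inter_subset_left⟩
          rintro rfl
          omega)
        (by simp)
      refine key.trans (le_of_eq ?_)
      by_cases h : A ∩ α = ∅ <;> simp [h, truncEuler_empty]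
    rw [inducedEuler_eq F _ hsup]
    refine (betaSum_le hle).trans (le_of_eq ?_)
    rw [betaSum_const_mul, betaSum_indicator le_rfl (Finset.empty_subset _),
      betaWeight_eq (by simp)]
    have : altSum (fun j => gNum (simplexBoundary α hα).faces α.card j / α.card.choose j) c
        = altSum (fun j => if j = 0 then 1 else 0) c := by
      refine altSum_congr fun j hj => ?_
      rw [gNum_simplexBoundary hα (by omega)]
      split_ifs with h <;> simp [h]
    rw [this, altSum_single]
    simp
    ring
  · intro j hj hjE
    rw [gNum_simplexBoundary hα (by omega), if_neg (by omega)]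

theorem HasStellatedBounds.move {k E : ℕ} {X Y : FiniteComplex V} {α β : Finset V}
    (hX : HasStellatedBounds F k E X) (h : IsBistellarMove X Y α β) (hβ : β.card ≤ k) :
    HasStellatedBounds F k E Y := by
  have hE := h.card_add_card hX.dim_eq
  refine ⟨h.dim_eq_dim.trans hX.dim_eq, ?_, ?_⟩
  · intro c hc
    have hb := hX.inducedEuler_le c hc
    have hU : α ∪ β ⊆ X.support ∪ Y.support ∪ (α ∪ β) := Finset.subset_union_right
    rw [inducedEuler_eq F X (W := X.support ∪ Y.support ∪ (α ∪ β))
      (by intro v; simp +contextual)] at hb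
    rw [inducedEuler_eq F Y (W := X.support ∪ Y.support ∪ (α ∪ β))
      (by intro v; simp +contextual)]
    -- From |β| ≤ k and c + k + 2 ≤ E follows c + 1 < |α|.
    refine (betaSum_le fun A _ => h.truncEuler_le F A (by omega)).trans ?_
    rw [betaSum_add, betaSum_const_mul, betaSum_indicator hU Finset.subset_union_right,
      h.card_union, hE, betaWeight_eq (by omega)]
    have : altSum (fun j => gNum Y.faces E j / E.choose j) c
        = altSum (fun j => gNum X.faces E j / E.choose j) c +
          altSum (fun j => if j = β.card then 1 / (E.choose β.card : ℚ) else 0) c := by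
      rw [← altSum_add]
      refine altSum_congr fun j hj => ?_
      rw [← hE, h.gNum_eq (by omega), add_div]
      split_ifs with hjb <;> simp [hjb]
    rw [this, altSum_single, mul_add]
    refine add_le_add hb (le_of_eq ?_)
    split_ifs
    · rw [one_div, one_div, one_div, mul_inv]; ring
    · simp
  · intro j hj hjE
    rw [← hE, h.gNum_eq (by omega), hE, hX.gNum_eq_zero j hj hjE, if_neg (by omega), add_zero]

theorem StellatedNat.hasStellatedBounds {k : ℕ} {X : FiniteComplex ℕ} (h : StellatedNat k X) :
    ∃ E, HasStellatedBounds F k E X := by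
  induction h with
  | standard α hα => exact ⟨_, hasStellatedBounds_simplexBoundary F k hα⟩
  | move X Y α β _ hmove hindex ih =>
    obtain ⟨E, hE⟩ := ih
    exact ⟨E, hE.move F hmove (by omega)⟩

end

end FiniteComplex

/-! ### Invariance under isomorphism. -/

namespace FiniteComplex

section

variable {V W : Type*} [LinearOrder V] [LinearOrder W] (F : Type*) [Field F]

theorem HasStellatedBounds.of_isIsomorphic {k E : ℕ} {X : FiniteComplex V} {Y : FiniteComplex W}
    (hXY : X.IsIsomorphic Y) (hY : HasStellatedBounds F k E Y) : HasStellatedBounds F k E X := by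
  obtain ⟨f, hf, hfaces⟩ := hXY
  have hf' : Set.InjOn f X.support := fun u hu v hv h =>
    hf (X.mem_support.1 hu) (X.mem_support.1 hv) h
  have hfs : ∀ s ∈ X.faces, Set.InjOn f s := fun s hs =>
    hf'.mono (by exact_mod_cast X.subset_support hs)
  have hcard : ∀ s ∈ X.faces, (s.image f).card = s.card := fun s hs =>
    Finset.card_image_of_injOn (hfs s hs)
  have hsub : ∀ s ∈ X.faces, ∀ A ⊆ X.support, s.image f ⊆ A.image f → s ⊆ A := by
    intro s hs A hA h v hv
    obtain ⟨u, hu, huv⟩ := Finset.mem_image.1 (h (Finset.mem_image_of_mem f hv))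
    exact hf' (hA hu) (X.subset_support hs hv) huv ▸ hu
  have hinj : Set.InjOn (Finset.image f) X.faces := fun s hs t ht h =>
    Finset.Subset.antisymm (hsub s hs t (X.subset_support ht) h.le)
      (hsub t ht s (X.subset_support hs) h.ge)
  have hres : ∀ A ⊆ X.support,
      restrict Y.faces (A.image f) = (restrict X.faces A).image (Finset.image f) := by
    intro A hA
    ext t
    simp only [restrict, Finset.mem_filter, hfaces, Finset.mem_image]
    constructor
    · rintro ⟨⟨s, hs, rfl⟩, h⟩
      exact ⟨s, ⟨hs, hsub s hs A hA h⟩, rfl⟩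
    · rintro ⟨s, ⟨hs, h⟩, rfl⟩
      exact ⟨⟨s, hs, rfl⟩, Finset.image_subset_image h⟩
  have hcount : ∀ K ⊆ X.faces, ∀ j, faceCount (K.image (Finset.image f)) j = faceCount K j := by
    intro K hK j
    rw [faceCount, faceCount, Finset.filter_image, Finset.card_image_of_injOn]
    · congr 2
      exact Finset.filter_congr fun s hs => by rw [hcard s (hK hs)]
    · exact hinj.mono fun s hs => hK (Finset.mem_filter.1 hs).1
  have hg : ∀ j, gNum Y.faces E j = gNum X.faces E j := fun j =>
    altSum_congr fun c _ => by rw [hfaces, hcount _ le_rfl]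
  refine ⟨?_, ?_, fun j hj hjE => by rw [← hg, hY.gNum_eq_zero j hj hjE]⟩
  · rw [← hY.dim_eq, dim, dim, hfaces, Finset.sup_image]
    congr 2
    exact Finset.sup_congr rfl fun s hs => (hcard s hs).symm
  · intro c hc
    have h := hY.inducedEuler_le c hc
    simp only [hg] at h
    refine le_trans ?_ h
    have hsupp : Y.support = X.support.image f := by
      ext w
      simp only [support, Finset.mem_sup, hfaces, Finset.mem_image, id]
      constructor
      · rintro ⟨_, ⟨s, hs, rfl⟩, hw⟩
        obtain ⟨v, hv, rfl⟩ := Finset.mem_image.1 hw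
        exact ⟨v, ⟨s, hs, hv⟩, rfl⟩
      · rintro ⟨v, ⟨s, hs, hv⟩, rfl⟩
        exact ⟨_, ⟨s, hs, rfl⟩, Finset.mem_image_of_mem f hv⟩
    rw [inducedEuler, inducedEuler, hsupp, betaSum_image hf']
    refine betaSum_le fun A hA => ?_
    rw [hres A hA, truncEuler, truncEuler]
    -- One inequality between the ranks suffices, since only an upper bound for X is transferred.
    have hr : (bdryRank F ((restrict X.faces A).image (Finset.image f)) (c + 1) : ℚ)
        ≤ bdryRank F (restrict X.faces A) (c + 1) := by
      exact_mod_cast bdryRank_image_le F f (fun s hs => hfs s (Finset.mem_filter.1 hs).1) _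
    rw [altSum_congr fun j _ => hcount (restrict X.faces A) (Finset.filter_subset _ _) j]
    linarith

theorem IsStellated.hasStellatedBounds {k E : ℕ} {X : FiniteComplex V} (h : X.IsStellated k)
    (hE : X.dim = (E : ℤ) - 2) : HasStellatedBounds F k E X := by
  obtain ⟨Y, hY, hXY⟩ := h
  obtain ⟨E', hE'⟩ := hY.hasStellatedBounds F
  have hX := hE'.of_isIsomorphic F hXY
  obtain rfl : E' = E := by
    have := hX.dim_eq
    omega
  exact hX

end

/-! ### Vertex links: Morse inequalities and g-numbers. -/

section Link

variable {V : Type*} [LinearOrder V] (F : Type*) [Field F]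

/-- The faces of the link of `x`. -/
def linkFaces (K : Finset (Finset V)) (x : V) : Finset (Finset V) :=
  K.filter fun s => x ∉ s ∧ insert x s ∈ K

theorem faceCount_restrict_insert (X : FiniteComplex V) {x : V} {A : Finset V} (hx : x ∉ A)
    (j : ℕ) : faceCount (restrict X.faces (insert x A)) j = faceCount (restrict X.faces A) j +
      if 1 ≤ j then faceCount (restrict (linkFaces X.faces x) A) (j - 1) else 0 := by
  have hsplit := Finset.card_filter_add_card_filter_not
    (s := (restrict X.faces (insert x A)).filter (fun s => s.card = j)) (fun s => x ∉ s)
  have h1 : ((restrict X.faces (insert x A)).filter (fun s => s.card = j)).filter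
      (fun s => x ∉ s) = (restrict X.faces A).filter (fun s => s.card = j) := by
    ext s
    simp only [restrict, Finset.mem_filter]
    constructor
    · rintro ⟨⟨⟨h1, h2⟩, h3⟩, h4⟩
      exact ⟨⟨h1, (Finset.subset_insert_iff_of_notMem h4).1 h2⟩, h3⟩
    · rintro ⟨⟨h1, h2⟩, h3⟩
      exact ⟨⟨⟨h1, h2.trans (Finset.subset_insert _ _)⟩, h3⟩, fun h => hx (h2 h)⟩
  have h2 : (((restrict X.faces (insert x A)).filter (fun s => s.card = j)).filter
      (fun s => ¬ x ∉ s)).card = if 1 ≤ j then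
        ((restrict (linkFaces X.faces x) A).filter (fun s => s.card = j - 1)).card else 0 := by
    split_ifs with hj
    · refine Finset.card_bij' (fun s _ => s.erase x) (fun s _ => insert x s) ?_ ?_ ?_ ?_
      · intro s hs
        simp only [restrict, linkFaces, Finset.mem_filter, not_not] at hs ⊢
        obtain ⟨⟨⟨h1, h2⟩, h3⟩, h4⟩ := hs
        refine ⟨⟨⟨X.down_closed s h1 _ (Finset.erase_subset _ _), Finset.notMem_erase _ _, ?_⟩,
          ?_⟩, ?_⟩
        · rwa [Finset.insert_erase h4]
        · rwa [← Finset.subset_insert_iff]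
        · rw [Finset.card_erase_of_mem h4, h3]
      · intro s hs
        simp only [restrict, linkFaces, Finset.mem_filter, not_not] at hs ⊢
        obtain ⟨⟨⟨h1, h2, h3⟩, h4⟩, h5⟩ := hs
        refine ⟨⟨⟨h3, Finset.insert_subset_insert _ h4⟩, ?_⟩, Finset.mem_insert_self _ _⟩
        rw [Finset.card_insert_of_notMem h2]
        omega
      · intro s hs
        simp only [Finset.mem_filter, not_not] at hs
        exact Finset.insert_erase hs.2
      · intro s hs
        simp only [restrict, linkFaces, Finset.mem_filter] at hs
        exact Finset.erase_insert hs.1.1.2.1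
    · rw [Finset.card_eq_zero, Finset.filter_eq_empty_iff]
      intro s hs h
      have h3 := Finset.card_pos.2 ⟨x, not_not.1 h⟩
      have h4 := (Finset.mem_filter.1 hs).2
      omega
  rw [h1, h2] at hsplit
  rw [faceCount, ← hsplit, faceCount]
  split_ifs <;> simp [faceCount]

/-- Attaching x is attaching a cone over its link in A: face counts add exactly, boundary ranks at
least add, and ranks enter negatively. -/
theorem truncEuler_insert_le (X : FiniteComplex V) {x : V} {A : Finset V} (hx : x ∉ A) (c : ℕ) :
    truncEuler F (restrict X.faces (insert x A)) (c + 1) ≤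
      truncEuler F (restrict X.faces A) (c + 1) +
        truncEuler F (restrict (linkFaces X.faces x) A) c := by
  have h := bdryRank_add_link_le F (K := restrict X.faces (insert x A)) (K₀ := restrict X.faces A)
    (L := restrict (linkFaces X.faces x) A) (c := c + 1) x
    (by
      intro s hs
      obtain ⟨h1, h2⟩ := Finset.mem_filter.1 hs
      exact ⟨Finset.mem_filter.2 ⟨h1, h2.trans (Finset.subset_insert _ _)⟩, fun h => hx (h2 h)⟩)
    (by
      intro s hs
      obtain ⟨h1, h2⟩ := Finset.mem_filter.1 hs
      obtain ⟨-, h3, h4⟩ := Finset.mem_filter.1 h1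
      exact ⟨Finset.mem_filter.2 ⟨h4, Finset.insert_subset_insert _ h2⟩, h3⟩)
  have h' : (bdryRank F (restrict X.faces A) (c + 1 + 1) : ℚ) +
      bdryRank F (restrict (linkFaces X.faces x) A) (c + 1) ≤
        bdryRank F (restrict X.faces (insert x A)) (c + 1 + 1) := by exact_mod_cast h
  rw [truncEuler, truncEuler, truncEuler,
    altSum_congr fun j _ => faceCount_restrict_insert X hx j, altSum_add,
    altSum_shift (faceCount (restrict (linkFaces X.faces x) A)), if_pos (by omega),
    Nat.add_sub_cancel]
  linarith

theorem truncEuler_restrict_empty_le (X : FiniteComplex V) (c : ℕ) :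
    truncEuler F (restrict X.faces ∅) c ≤ (-1) ^ c := by
  have h : altSum (faceCount (restrict X.faces ∅)) c = altSum (fun j => if j = 0 then 1 else 0) c := by
    refine altSum_congr fun j _ => ?_
    have h1 : restrict X.faces ∅ = {∅} := by
      ext s
      simp only [restrict, Finset.mem_filter, Finset.subset_empty, Finset.mem_singleton]
      exact ⟨fun h => h.2, fun h => ⟨h ▸ X.empty_mem, h⟩⟩
    rw [faceCount, h1, Finset.filter_singleton, Finset.card_empty]
    rcases eq_or_ne j 0 with rfl | hj
    · simp
    · rw [if_neg hj.symm, if_neg hj]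
      simp
  rw [truncEuler, h, altSum_single]
  simp

/-- The Morse inequalities, averaged over all orderings of the vertices. -/
theorem truncEuler_le_sum_link (X : FiniteComplex V) (c : ℕ) :
    truncEuler F X.faces (c + 1) ≤ (-1) ^ (c + 1) + ∑ x ∈ X.support,
      betaSum (X.support.erase x) (fun A => truncEuler F (restrict (linkFaces X.faces x) A) c) := by
  have h := sum_betaSum_erase X.support (fun A => truncEuler F (restrict X.faces A) (c + 1))
  have h0 := truncEuler_restrict_empty_le F X (c + 1)
  have h1 : restrict X.faces X.support = X.faces :=
    Finset.filter_true_of_mem fun s hs => X.subset_support hs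
  have h2 : ∑ x ∈ X.support, betaSum (X.support.erase x) (fun A =>
      truncEuler F (restrict X.faces (insert x A)) (c + 1) -
        truncEuler F (restrict X.faces A) (c + 1)) ≤ ∑ x ∈ X.support,
      betaSum (X.support.erase x) (fun A => truncEuler F (restrict (linkFaces X.faces x) A) c) := by
    refine Finset.sum_le_sum fun x _ => betaSum_le fun A hA => ?_
    have := truncEuler_insert_le F X (x := x) (A := A)
      (fun h => by simpa using hA h) c
    linarith
  rw [h1] at h
  linarith

/-- The ground set may contain vertices outside the link; by `betaSum_inter` they do not affect the
average. -/
theorem inducedEuler_link (X : FiniteComplex V) {x : V} (hx : X.IsVertex x) (c : ℕ) :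
    (X.link x hx).inducedEuler F c =
      betaSum (X.support.erase x) (fun A => truncEuler F (restrict (linkFaces X.faces x) A) c) := by
  refine inducedEuler_eq F _ (Finset.sup_le fun s hs => ?_) c
  obtain ⟨h1, h2, -⟩ := Finset.mem_filter.1 hs
  exact Finset.subset_erase.2 ⟨X.subset_support h1, h2⟩

theorem sum_faceCount_link (X : FiniteComplex V) (c : ℕ) :
    ∑ x ∈ X.support, faceCount (linkFaces X.faces x) c = (c + 1) * faceCount X.faces (c + 1) := by
  have h1 : ∀ x ∈ X.support, (faceCount (linkFaces X.faces x) c : ℚ) =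
      ∑ s ∈ X.faces.filter (fun s => s.card = c + 1) with x ∈ s, 1 := by
    intro x _
    rw [Finset.sum_const, nsmul_one, faceCount]
    congr 1
    symm
    refine Finset.card_bij' (fun s _ => s.erase x) (fun s _ => insert x s) ?_ ?_ ?_ ?_
    · intro s hs
      simp only [linkFaces, Finset.mem_filter] at hs ⊢
      obtain ⟨⟨h1, h2⟩, h3⟩ := hs
      refine ⟨⟨X.down_closed s h1 _ (Finset.erase_subset _ _), Finset.notMem_erase _ _, ?_⟩, ?_⟩
      · rwa [Finset.insert_erase h3]
      · rw [Finset.card_erase_of_mem h3, h2, Nat.add_sub_cancel]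
    · intro s hs
      simp only [linkFaces, Finset.mem_filter] at hs ⊢
      exact ⟨⟨hs.1.2.2, by rw [Finset.card_insert_of_notMem hs.1.2.1, hs.2]⟩,
        Finset.mem_insert_self _ _⟩
    · intro s hs
      exact Finset.insert_erase (Finset.mem_filter.1 hs).2
    · intro s hs
      simp only [linkFaces, Finset.mem_filter] at hs
      exact Finset.erase_insert hs.1.2.1
  rw [Finset.sum_congr rfl h1, Finset.sum_comm' (t' := X.faces.filter (fun s => s.card = c + 1))
    (s' := fun s => s)]
  · simp only [Finset.sum_const, nsmul_one]
    rw [Finset.sum_congr rfl (g := fun _ => ((c + 1 : ℕ) : ℚ))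
      fun s hs => by rw [(Finset.mem_filter.1 hs).2], Finset.sum_const, nsmul_eq_mul, faceCount]
    push_cast
    ring
  · intro x s
    simp only [Finset.mem_filter]
    exact ⟨fun h => ⟨h.2.2, h.2.1⟩, fun h => ⟨X.subset_support h.2.1 h.1, h.2, h.1⟩⟩

theorem sum_gNum_link (X : FiniteComplex V) {D j : ℕ} (hj : j ≤ D) :
    ∑ x ∈ X.support, gNum (linkFaces X.faces x) D j =
      (j + 1) * gNum X.faces (D + 1) (j + 1) + (D + 1 - j) * gNum X.faces (D + 1) j := by
  have h1 : ∑ x ∈ X.support, gNum (linkFaces X.faces x) D j = ∑ c ∈ Finset.range (j + 1),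
      (-1) ^ (j - c) * (((D - c).choose (j - c) : ℚ) * ((c + 1) * faceCount X.faces (c + 1))) := by
    simp only [gNum, altSum]
    rw [Finset.sum_comm]
    refine Finset.sum_congr rfl fun c _ => ?_
    rw [← sum_faceCount_link, Finset.mul_sum, Finset.mul_sum]
  have h2 : (j + 1) * gNum X.faces (D + 1) (j + 1) + (D + 1 - j) * gNum X.faces (D + 1) j =
      ∑ c ∈ Finset.range (j + 2), (-1) ^ (j + 1 - c) *
        (((D + 1 - c).choose (j + 1 - c) : ℚ) * (c * faceCount X.faces c)) := by
    rw [gNum, altSum, Finset.sum_range_succ, Finset.sum_range_succ _ (j + 1), mul_add,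
      add_right_comm, gNum, altSum, Finset.mul_sum, Finset.mul_sum, ← Finset.sum_add_distrib]
    congr 1
    · refine Finset.sum_congr rfl fun c hc => ?_
      have hc' : c ≤ j := Nat.lt_succ_iff.1 (Finset.mem_range.1 hc)
      obtain ⟨i, rfl⟩ : ∃ i, j = c + i := ⟨j - c, by omega⟩
      obtain ⟨n, rfl⟩ : ∃ n, D = c + i + n := ⟨D - (c + i), by omega⟩
      have e1 : c + i + 1 - c = i + 1 := by omega
      have e2 : c + i - c = i := by omega
      have e3 : c + i + n + 1 - c = i + n + 1 := by omega
      rw [e1, e2, e3]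
      -- (j + 1 - c) C(D + 1 - c, j + 1 - c) = (D + 1 - j) C(D + 1 - c, j - c) merges the two
      -- coefficients of the c-element face count into c C(D + 1 - c, j + 1 - c), up to sign.
      have h := Nat.choose_succ_right_eq (i + n + 1) i
      have e4 : i + n + 1 - i = n + 1 := by omega
      rw [e4] at h
      have h' : ((i + n + 1).choose (i + 1) : ℚ) * (i + 1) = (i + n + 1).choose i * (n + 1) := by
        exact_mod_cast h
      push_cast
      rw [pow_succ]
      linear_combination (-(-1) ^ i * faceCount X.faces c) * h'
    · simp
  rw [h1, h2, Finset.sum_range_succ' _ (j + 1)]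
  simp

end Link

end FiniteComplex

/-! ### Betti numbers in terms of boundary ranks. -/

namespace FiniteComplex

open Submodule Module

section Chains

variable {V : Type*} (F : Type*) [Field F] (X : FiniteComplex V)

/-- Chains of `X`, viewed as combinations of finite sets. -/
noncomputable def chainIncl (i : ℕ) : X.Chain F i →ₗ[F] (Finset V →₀ F) :=
  Finsupp.lmapDomain F F Subtype.val ∘ₗ
    (Finsupp.linearEquivFunOnFinite F F (X.facesOfCard (i + 1))).symm.toLinearMap

theorem chainIncl_injective (i : ℕ) : Function.Injective (X.chainIncl F i) :=
  (Finsupp.mapDomain_injective Subtype.val_injective).comp (LinearEquiv.injective _)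

theorem chainIncl_apply (i : ℕ) (h : X.Chain F i) (t : X.facesOfCard (i + 1)) :
    X.chainIncl F i h t.1 = h t :=
  Finsupp.mapDomain_apply Subtype.val_injective _ _

theorem chainIncl_apply_of_notMem (i : ℕ) (h : X.Chain F i) {t : Finset V}
    (ht : t ∉ X.facesOfCard (i + 1)) : X.chainIncl F i h t = 0 :=
  Finsupp.mapDomain_of_notMem_range _ _ (by simpa using ht)

theorem finrank_chain (i : ℕ) : (finrank F (X.Chain F i) : ℚ) = faceCount X.faces (i + 1) := by
  rw [finrank_fintype_fun_eq_card, Fintype.card_coe]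
  rfl

end Chains

section

variable {V : Type*} [LinearOrder V] (F : Type*) [Field F]

/-- The boundary map of the augmented chain complex of all finite subsets of `V`. -/
noncomputable def fullBdry : (Finset V →₀ F) →ₗ[F] (Finset V →₀ F) :=
  Finsupp.linearCombination F (simplexBdry F)

theorem fullBdry_single (s : Finset V) (a : F) :
    fullBdry F (Finsupp.single s a) = a • simplexBdry F s :=
  Finsupp.linearCombination_single F a s

theorem card_filter_erase_lt {s : Finset V} {x v : V} (hv : v ∈ s) :
    ((s.erase v).filter (fun w => w < x)).card + (if v < x then 1 else 0)
      = (s.filter (fun w => w < x)).card := by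
  rw [Finset.filter_erase]
  split_ifs with h
  · rw [Finset.card_erase_add_one (by simp [hv, h])]
  · rw [Finset.erase_eq_of_notMem (by simp [h]), add_zero]

theorem fullBdry_simplexBdry (s : Finset V) : fullBdry F (simplexBdry F s) = 0 := by
  rw [simplexBdry, map_sum]
  simp only [fullBdry_single, simplexBdry, Finset.smul_sum, Finsupp.smul_single, smul_eq_mul]
  rw [Finset.sum_sigma']
  -- The two orders of deleting v and w cancel: deleting the smaller first shifts the position of
  -- the larger by one.
  refine Finset.sum_involution (fun p _ => ⟨p.2, p.1⟩) ?_ ?_ ?_ ?_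
  · rintro ⟨v, w⟩ h
    simp only [Finset.mem_sigma, Finset.mem_erase] at h
    have h1 := card_filter_erase_lt (x := w) h.1
    have h2 := card_filter_erase_lt (x := v) h.2.2
    dsimp only
    rw [Finset.erase_right_comm, ← Finsupp.single_add, ← h1, ← h2]
    rcases lt_or_gt_of_ne h.2.1 with h3 | h3
    · rw [if_neg h3.not_gt, if_pos h3]
      refine (congrArg _ ?_).trans (Finsupp.single_zero _)
      ring
    · rw [if_neg h3.not_gt, if_pos h3]
      refine (congrArg _ ?_).trans (Finsupp.single_zero _)
      ring
  · rintro ⟨v, w⟩ h _ heq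
    simp only [Finset.mem_sigma, Finset.mem_erase] at h
    simp only [Sigma.mk.injEq, heq_eq_eq] at heq
    exact h.2.1 heq.1
  · rintro ⟨v, w⟩ h
    simp only [Finset.mem_sigma, Finset.mem_erase] at h ⊢
    exact ⟨h.2.2, h.2.1.symm, h.1⟩
  · rintro ⟨v, w⟩ _
    rfl

variable (X : FiniteComplex V)

theorem chainIncl_single (i : ℕ) (s : X.facesOfCard (i + 1)) :
    X.chainIncl F i (Pi.single s 1) = Finsupp.single s.1 1 := by
  ext t
  by_cases ht : t ∈ X.facesOfCard (i + 1)
  · have := X.chainIncl_apply F i (Pi.single s 1) ⟨t, ht⟩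
    rw [this, Finsupp.single_apply, Pi.single_apply]
    congr 1
    rw [Subtype.ext_iff]
    exact propext eq_comm
  · rw [X.chainIncl_apply_of_notMem F i _ ht, Finsupp.single_apply, if_neg]
    rintro rfl
    exact ht s.2

theorem fullBdry_chainIncl (i : ℕ) (h : X.Chain F (i + 1)) :
    fullBdry F (X.chainIncl F (i + 1) h) = X.chainIncl F i (X.boundary F i h) := by
  suffices H : fullBdry F ∘ₗ X.chainIncl F (i + 1) = X.chainIncl F i ∘ₗ X.boundary F i from
    LinearMap.congr_fun H h
  refine LinearMap.pi_ext' fun s => LinearMap.ext_ring ?_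
  simp only [LinearMap.coe_comp, Function.comp_apply, LinearMap.coe_single]
  rw [chainIncl_single, fullBdry_single, one_smul]
  ext t
  rw [simplexBdry_apply]
  by_cases ht : t ∈ X.facesOfCard (i + 1)
  · have := X.chainIncl_apply F i (X.boundary F i (Pi.single s 1)) ⟨t, ht⟩
    rw [this]
    simp [boundary]
  · rw [X.chainIncl_apply_of_notMem F i _ ht, incidence, Finset.sum_eq_zero, Int.cast_zero]
    intro v hv
    rw [if_neg]
    rintro rfl
    obtain ⟨h1, h2⟩ := Finset.mem_filter.1 s.2
    refine ht (Finset.mem_filter.2 ⟨X.down_closed _ h1 _ (Finset.erase_subset _ _), ?_⟩)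
    rw [Finset.card_erase_of_mem hv, h2, Nat.add_sub_cancel]

theorem boundary_boundary (i : ℕ) (h : X.Chain F (i + 2)) :
    X.boundary F i (X.boundary F (i + 1) h) = 0 := by
  apply X.chainIncl_injective F i
  rw [← fullBdry_chainIncl, ← fullBdry_chainIncl, map_zero]
  have H : fullBdry F ∘ₗ fullBdry F = (0 : (Finset V →₀ F) →ₗ[F] (Finset V →₀ F)) := by
    refine Finsupp.lhom_ext fun s a => ?_
    rw [LinearMap.comp_apply, fullBdry_single, map_smul, fullBdry_simplexBdry, smul_zero,
      LinearMap.zero_apply]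
  exact LinearMap.congr_fun H _

/-- Passes from the matrix boundary defining homology to the spans in which the rank estimates are
made. -/
theorem finrank_range_boundary (i : ℕ) :
    finrank F (LinearMap.range (X.boundary F i)) = bdryRank F X.faces (i + 2) := by
  rw [LinearEquiv.finrank_eq (Submodule.equivMapOfInjective _ (X.chainIncl_injective F i) _),
    bdryRank]
  have h1 : (LinearMap.range (X.boundary F i)).map (X.chainIncl F i) =
      (LinearMap.range (X.chainIncl F (i + 1))).map (fullBdry F) := by
    rw [← LinearMap.range_comp, ← LinearMap.range_comp]
    congr 1
    exact LinearMap.ext fun h => (X.fullBdry_chainIncl F i h).symm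
  have h2 : LinearMap.range (X.chainIncl F (i + 1)) =
      span F (Set.range fun s : X.facesOfCard (i + 2) => Finsupp.single s.1 (1 : F)) := by
    rw [← Submodule.map_top, ← (Pi.basisFun F _).span_eq, Submodule.map_span, ← Set.range_comp]
    congr 2
    ext1 s
    rw [Function.comp_apply, Pi.basisFun_apply, chainIncl_single]
  have h3 : Set.range (fullBdry F ∘ fun s : X.facesOfCard (i + 2) => Finsupp.single s.1 (1 : F)) =
      simplexBdry F '' {s | s ∈ X.faces ∧ s.card = i + 2} := by
    ext g
    simp only [Set.mem_range, Function.comp_apply, fullBdry_single, one_smul, Set.mem_image,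
      Subtype.exists, facesOfCard, Finset.mem_filter, Set.mem_ofPred_eq, exists_prop]
  rw [h1, h2, Submodule.map_span, ← Set.range_comp, h3]

theorem betti_add_rank (i : ℕ) :
    X.betti F i + bdryRank F X.faces (i + 2) = finrank F (X.cycles F i) := by
  have hle : LinearMap.range (X.boundary F i) ≤ X.cycles F i := by
    cases i with
    | zero => exact le_top
    | succ i =>
      rintro _ ⟨h, rfl⟩
      exact X.boundary_boundary F i h
  rw [betti, ← finrank_range_boundary, ← (Submodule.submoduleOfEquivOfLe hle).finrank_eq]
  exact Submodule.finrank_quotient_add_finrank _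

theorem betti_succ (i : ℕ) : (X.betti F (i + 1) : ℚ) =
    faceCount X.faces (i + 2) - bdryRank F X.faces (i + 2) - bdryRank F X.faces (i + 3) := by
  have h1 := X.betti_add_rank F (i + 1)
  have h2 := LinearMap.finrank_range_add_finrank_ker (X.boundary F i)
  rw [finrank_range_boundary] at h2
  have h3 := X.finrank_chain F (i + 1)
  rw [← h3, ← h2]
  have h4 : (X.betti F (i + 1) : ℚ) + bdryRank F X.faces (i + 3) =
    finrank F (LinearMap.ker (X.boundary F i)) := by exact_mod_cast h1
  push_cast
  linarith

theorem simplexBdry_pair {u v : V} (h : u < v) :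
    simplexBdry F {u, v} = Finsupp.single {v} 1 - Finsupp.single {u} 1 := by
  have e1 : ({u, v} : Finset V).erase u = {v} := by
    rw [Finset.erase_insert (by simpa using h.ne)]
  have e2 : ({u, v} : Finset V).erase v = {u} := by
    rw [Finset.pair_comm, Finset.erase_insert (by simpa using h.ne')]
  have e3 : ({u, v} : Finset V).filter (fun w => w < u) = ∅ := by
    ext w
    simp only [Finset.mem_filter, Finset.mem_insert, Finset.mem_singleton, Finset.notMem_empty,
      iff_false, not_and, not_lt]
    rintro (rfl | rfl)
    exacts [le_rfl, h.le]
  have e4 : ({u, v} : Finset V).filter (fun w => w < v) = {u} := by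
    ext w
    simp only [Finset.mem_filter, Finset.mem_insert, Finset.mem_singleton]
    constructor
    · rintro ⟨rfl | rfl, h'⟩
      exacts [rfl, absurd h' (lt_irrefl _)]
    · rintro rfl
      exact ⟨Or.inl rfl, h⟩
  rw [simplexBdry, Finset.sum_insert (by simpa using h.ne), Finset.sum_singleton, e1, e2, e3, e4]
  simp [sub_eq_add_neg]

/-- This is the vanishing of reduced homology in degree 0. -/
theorem bdryRank_two_add_one (hX : X.IsConnected) :
    (bdryRank F X.faces 2 : ℚ) + 1 = faceCount X.faces 1 := by
  obtain ⟨⟨v₀, hv₀⟩⟩ := hX.nonempty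
  let S := simplexBdry F '' {s | s ∈ X.faces ∧ s.card = 2}
  let T : Set (Finset V →₀ F) := Set.range
    fun s : X.faces.filter (fun s => s.card = 1) => Finsupp.single s.1 (1 : F)
  have hS : S.Finite := finite_simplexBdry_image F _ _
  have hT : finrank F (span F T) = (X.faces.filter (fun s => s.card = 1)).card := by
    have := finrank_span_eq_card (R := F)
      (b := fun s : X.faces.filter (fun s => s.card = 1) => Finsupp.single s.1 (1 : F))
      ((Finsupp.linearIndependent_single_one F (Finset V)).comp _ Subtype.val_injective)
    rwa [Fintype.card_coe] at this
  have hmemT : ∀ v, X.IsVertex v → Finsupp.single {v} (1 : F) ∈ T := fun v hv =>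
    ⟨⟨{v}, Finset.mem_filter.2 ⟨hv, Finset.card_singleton v⟩⟩, rfl⟩
  have hST : span F S ≤ span F T := by
    rw [span_le]
    rintro _ ⟨s, ⟨hs, hc⟩, rfl⟩
    obtain ⟨u, v, huv, rfl⟩ : ∃ u v, u < v ∧ s = {u, v} := by
      obtain ⟨u, v, huv, rfl⟩ := Finset.card_eq_two.1 hc
      rcases lt_or_gt_of_ne huv with h | h
      exacts [⟨u, v, h, rfl⟩, ⟨v, u, h, Finset.pair_comm _ _⟩]
    rw [simplexBdry_pair F huv]
    exact sub_mem (subset_span (hmemT v (X.down_closed _ hs _ (by simp))))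
      (subset_span (hmemT u (X.down_closed _ hs _ (by simp))))
  have hle : bdryRank F X.faces 2 + 1 ≤ (X.faces.filter (fun s => s.card = 1)).card := by
    -- The augmentation kills boundaries of edges but not the vertex v₀.
    have key := finrank_span_add_finrank_span_map_le (fullBdry F) (S := S)
      (T := {Finsupp.single {v₀} (1 : F)}) (U := S ∪ T) (hS.union (Set.finite_range _))
      Set.subset_union_left
      (Set.singleton_subset_iff.2 (Set.mem_union_right _ (hmemT v₀ hv₀)))
      (by rintro _ ⟨s, -, rfl⟩; exact fullBdry_simplexBdry F s)
    have h1 : fullBdry F (Finsupp.single {v₀} (1 : F)) ≠ 0 := by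
      rw [fullBdry_single, one_smul, simplexBdry, Finset.sum_singleton]
      simp
    rw [Set.image_singleton, finrank_span_singleton h1, span_union, sup_eq_right.2 hST, hT] at key
    exact key
  have hge : (X.faces.filter (fun s => s.card = 1)).card ≤ bdryRank F X.faces 2 + 1 := by
    -- A walk writes v - u as a combination of edge boundaries, so these and v₀ span all vertices.
    have hwalk : ∀ u v : {v : V // X.IsVertex v}, X.edgeGraph.Walk u v →
        Finsupp.single {v.1} (1 : F) - Finsupp.single {u.1} (1 : F) ∈ span F S := by
      intro u v p
      induction p with
      | nil => rw [sub_self]; exact zero_mem _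
      | @cons u v w h _ ih =>
        have h1 : Finsupp.single {v.1} (1 : F) - Finsupp.single {u.1} (1 : F) ∈ span F S := by
          have hne : u.1 ≠ v.1 := fun e => h.1 (Subtype.ext e)
          have hmem : simplexBdry F {u.1, v.1} ∈ span F S :=
            subset_span ⟨_, ⟨h.2, Finset.card_pair hne⟩, rfl⟩
          rcases lt_or_gt_of_ne hne with h' | h'
          · rwa [simplexBdry_pair F h'] at hmem
          · rw [Finset.pair_comm, simplexBdry_pair F h'] at hmem
            simpa using neg_mem hmem
        simpa using add_mem ih h1
    have : FiniteDimensional F (span F S) := FiniteDimensional.span_of_finite F hS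
    have hTle : span F T ≤ span F S ⊔ span F {Finsupp.single {v₀} (1 : F)} := by
      rw [span_le]
      rintro _ ⟨⟨s, hs⟩, rfl⟩
      obtain ⟨h1, h2⟩ := Finset.mem_filter.1 hs
      obtain ⟨v, rfl⟩ := Finset.card_eq_one.1 h2
      obtain ⟨p⟩ := hX.preconnected ⟨v₀, hv₀⟩ ⟨v, h1⟩
      have := Submodule.add_mem_sup (hwalk _ _ p) (mem_span_singleton_self
        (R := F) (Finsupp.single ({v₀} : Finset V) (1 : F)))
      simpa using this
    rw [← hT]
    refine (Submodule.finrank_mono hTle).trans ((Submodule.finrank_add_le_finrank_add_finrank _ _).trans ?_)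
    refine Nat.add_le_add_left ?_ _
    exact (finrank_span_singleton (K := F) (by simp)).le
  rw [faceCount]
  exact_mod_cast le_antisymm hle hge

theorem faceCount_zero : faceCount X.faces 0 = 1 := by
  have : X.faces.filter (fun s => s.card = 0) = {∅} := by
    ext s
    simp only [Finset.mem_filter, Finset.card_eq_zero, Finset.mem_singleton]
    exact ⟨fun h => h.2, fun h => ⟨h ▸ X.empty_mem, h⟩⟩
  rw [faceCount, this]
  simp

/-- The sum starts at i = 1 because the reduced Betti number in degree 0 is zero; higher up the
ranks telescope. -/
theorem altSum_betti (hX : X.IsConnected) (l : ℕ) :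
    altSum (fun i => if 1 ≤ i then (X.betti F i : ℚ) else 0) l = truncEuler F X.faces (l + 1) := by
  induction l with
  | zero =>
    have := X.bdryRank_two_add_one F hX
    rw [altSum_zero, if_neg (by omega), truncEuler, altSum_succ, altSum_zero, faceCount_zero]
    simp only [zero_add, Nat.reduceAdd]
    linarith
  | succ l ih =>
    rw [altSum_succ, ih, if_pos (by omega), betti_succ, truncEuler, truncEuler, altSum_succ _ (l + 1)]
    ring

theorem sum_betti_eq_truncEuler (hX : X.IsConnected) (l : ℕ) :
    ∑ i ∈ Finset.Icc 1 l, (-1) ^ (l - i) * (X.betti F i : ℚ) = truncEuler F X.faces (l + 1) := by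
  rw [← X.altSum_betti F hX, altSum]
  have : Finset.Icc 1 l ⊆ Finset.range (l + 1) := fun i hi => by
    rw [Finset.mem_Icc] at hi
    exact Finset.mem_range.2 (by omega)
  rw [← Finset.sum_subset this]
  · exact Finset.sum_congr rfl fun i hi => by rw [if_pos (Finset.mem_Icc.1 hi).1]
  · intro i hi hi'
    rw [Finset.mem_range] at hi
    rw [Finset.mem_Icc] at hi'
    rw [if_neg (by omega), mul_zero]

end

end FiniteComplex

/-! ### Comparison of g-numbers and Betti numbers. -/

namespace FiniteComplex

theorem altSum_succ_add (G : ℕ → ℚ) (l : ℕ) :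
    altSum (fun j => G (j + 1) + G j) l = G (l + 1) + (-1) ^ l * G 0 := by
  induction l with
  | zero => simp [altSum_zero]
  | succ l ih => rw [altSum_succ, ih, pow_succ]; ring

section

variable {V : Type*}

theorem gNumber_eq_gNum (X : FiniteComplex V) (d j : ℕ) :
    (X.gNumber d j : ℚ) = gNum X.faces (d + 2) j := by
  rw [gNumber, gNum, altSum]
  push_cast
  refine Finset.sum_congr rfl fun c _ => ?_
  rw [mul_assoc]
  rfl

/-- The `g`-number divided by its coefficient in the lower bound theorem. -/
def normG (M : FiniteComplex V) (d j : ℕ) : ℚ := gNum M.faces (d + 2) j / (d + 2).choose j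

theorem gNumber_eq_mul_normG (M : FiniteComplex V) {d j : ℕ} (hj : j ≤ d + 2) :
    (M.gNumber d j : ℚ) = (d + 2).choose j * M.normG d j := by
  have h : ((d + 2).choose j : ℚ) ≠ 0 := by exact_mod_cast (Nat.choose_pos hj).ne'
  rw [gNumber_eq_gNum, normG, mul_div_cancel₀ _ h]

variable [LinearOrder V] (F : Type*) [Field F] {k d : ℕ} {M : FiniteComplex V}

/-- Dividing by C(d + 2, j) is the normalisation that turns both coefficients in `sum_gNum_link`
into 1. -/
theorem sum_gNum_link_eq_normG {j : ℕ} (hj : j ≤ d + 1) :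
    1 / (d + 2) * ((∑ x ∈ M.support, gNum (linkFaces M.faces x) (d + 1) j) / (d + 1).choose j)
      = M.normG d (j + 1) + M.normG d j := by
  rw [sum_gNum_link M hj, normG, normG]
  have h1 : ((d + 2 : ℕ) : ℚ) * (d + 1).choose j = (d + 2).choose (j + 1) * (j + 1 : ℕ) := by
    exact_mod_cast Nat.add_one_mul_choose_eq (d + 1) j
  have h2 : ((d + 2).choose (j + 1) : ℚ) * (j + 1 : ℕ) = (d + 2).choose j * (d + 2 - j : ℕ) := by
    exact_mod_cast Nat.choose_succ_right_eq (d + 2) j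
  have h0 : ((d + 1).choose j : ℚ) ≠ 0 := by exact_mod_cast (Nat.choose_pos hj).ne'
  have h3 : ((d + 2).choose j : ℚ) ≠ 0 := by
    exact_mod_cast (Nat.choose_pos (hj.trans (Nat.le_succ _))).ne'
  have h4 : ((d + 2).choose (j + 1) : ℚ) ≠ 0 := by
    exact_mod_cast (Nat.choose_pos (Nat.succ_le_succ hj)).ne'
  have h5 : ((d + 2 - j : ℕ) : ℚ) = d + 2 - j := by
    rw [Nat.cast_sub (hj.trans (Nat.le_succ _))]
    push_cast
    ring
  rw [h5] at h2
  have h6 : (d : ℚ) + 2 ≠ 0 := by positivity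
  push_cast at h1 h2 ⊢
  have e1 : ((j : ℚ) + 1) / ((d + 2) * (d + 1).choose j) = 1 / (d + 2).choose (j + 1) := by
    rw [div_eq_div_iff (mul_ne_zero h6 h0) h4]
    linarith
  have e2 : ((d : ℚ) + 2 - j) / ((d + 2) * (d + 1).choose j) = 1 / (d + 2).choose j := by
    rw [div_eq_div_iff (mul_ne_zero h6 h0) h3]
    linarith
  calc _ = ((j : ℚ) + 1) / ((d + 2) * (d + 1).choose j) * gNum M.faces (d + 1 + 1) (j + 1)
        + ((d : ℚ) + 2 - j) / ((d + 2) * (d + 1).choose j) * gNum M.faces (d + 1 + 1) j := by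
          field_simp
          ring
    _ = _ := by rw [e1, e2]; ring

theorem MemW.hasStellatedBounds_link (hM : M.MemW k d) {x : V} (hx : M.IsVertex x) :
    HasStellatedBounds F k (d + 1) (M.link x hx) := by
  refine (hM.link_stellated x hx).hasStellatedBounds F ?_
  rw [hM.link_dim x hx]
  push_cast
  ring

theorem MemW.truncEuler_le_normG (hM : M.MemW k d) {l : ℕ} (hl : l + k + 1 ≤ d) :
    truncEuler F M.faces (l + 1) ≤ M.normG d (l + 1) := by
  have h1 : ∑ x ∈ M.support,
      betaSum (M.support.erase x) (fun A => truncEuler F (restrict (linkFaces M.faces x) A) l) ≤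
      ∑ x ∈ M.support, 1 / ((d : ℚ) + 2) *
        altSum (fun j => gNum (linkFaces M.faces x) (d + 1) j / (d + 1).choose j) l := by
    refine Finset.sum_le_sum fun x hx => ?_
    have hx' := M.mem_support.1 hx
    have h := (hM.hasStellatedBounds_link F hx').inducedEuler_le l (by omega)
    rw [inducedEuler_link] at h
    push_cast at h
    rw [add_assoc, one_add_one_eq_two] at h
    exact h
  have h2 : ∑ x ∈ M.support, 1 / ((d : ℚ) + 2) *
      altSum (fun j => gNum (linkFaces M.faces x) (d + 1) j / (d + 1).choose j) l
      = altSum (fun j => M.normG d (j + 1) + M.normG d j) l := by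
    rw [← Finset.mul_sum]
    simp only [altSum]
    rw [Finset.sum_comm, Finset.mul_sum]
    refine Finset.sum_congr rfl fun j hj => ?_
    have := Finset.mem_range.1 hj
    rw [← sum_gNum_link_eq_normG (by omega), ← Finset.mul_sum, Finset.sum_div]
    ring
  -- The end term (-1)^l G 0 of the telescoping cancels the empty face's (-1)^(l + 1) in the Morse
  -- inequality.
  have h3 : M.normG d 0 = 1 := by
    simp [normG, gNum, altSum_zero, faceCount_zero]
  have h4 := M.truncEuler_le_sum_link F l
  rw [altSum_succ_add, h3] at h2
  rw [h2] at h1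
  rw [pow_succ] at h4
  linarith

theorem MemW.normG_succ_add (hM : M.MemW k d) {j : ℕ} (hkj : k < j) (hj : j + k + 1 ≤ d) :
    M.normG d (j + 1) + M.normG d j = 0 := by
  rw [← sum_gNum_link_eq_normG (by omega), Finset.sum_eq_zero, zero_div, mul_zero]
  intro x hx
  -- The g-numbers do not involve the field, so any field serves.
  exact (hM.hasStellatedBounds_link ℚ (M.mem_support.1 hx)).gNum_eq_zero j hkj (by omega)

theorem truncEuler_succ_add (hM : M.IsConnected) (l : ℕ) :
    truncEuler F M.faces (l + 2) + truncEuler F M.faces (l + 1) = M.betti F (l + 1) := by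
  rw [← M.altSum_betti F hM, ← M.altSum_betti F hM, altSum_succ, if_pos (by omega)]
  ring

theorem MemW.truncEuler_eq_normG (hM : M.MemW k d) (hd : 2 * k + 2 ≤ d) {l : ℕ} (hkl : k ≤ l)
    (hl : l + k + 1 ≤ d) : truncEuler F M.faces (l + 1) = M.normG d (l + 1) := by
  refine le_antisymm (hM.truncEuler_le_normG F hl) ?_
  rcases hkl.eq_or_lt with rfl | hkl
  · have h1 := hM.truncEuler_le_normG F (l := k + 1) (by omega)
    have h2 := truncEuler_succ_add F hM.connected k
    have h3 := hM.normG_succ_add (j := k + 1) (by omega) (by omega)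
    have h4 : (0 : ℚ) ≤ M.betti F (k + 1) := Nat.cast_nonneg _
    linarith
  · obtain ⟨m, rfl⟩ : ∃ m, l = m + 1 := ⟨l - 1, by omega⟩
    have h1 := hM.truncEuler_le_normG F (l := m) (by omega)
    have h2 := truncEuler_succ_add F hM.connected m
    have h3 := hM.normG_succ_add (j := m + 1) (by omega) (by omega)
    have h4 : (0 : ℚ) ≤ M.betti F (m + 1) := Nat.cast_nonneg _
    linarith

theorem MemW.choose_mul_sum_betti_le (hM : M.MemW k d) {l : ℕ} (hl : l + k + 1 ≤ d) :
    ((d + 2).choose (l + 1) : ℤ) * ∑ i ∈ Finset.Icc 1 l, (-1) ^ (l - i) * (M.betti F i : ℤ)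
      ≤ M.gNumber d (l + 1) := by
  have h : ((d + 2).choose (l + 1) : ℚ) * ∑ i ∈ Finset.Icc 1 l, (-1) ^ (l - i) * (M.betti F i : ℚ)
      ≤ M.gNumber d (l + 1) := by
    rw [M.sum_betti_eq_truncEuler F hM.connected, gNumber_eq_mul_normG _ (by omega)]
    exact mul_le_mul_of_nonneg_left (hM.truncEuler_le_normG F hl) (Nat.cast_nonneg _)
  exact_mod_cast h

theorem MemW.gNumber_eq (hM : M.MemW k d) (hd : 2 * k + 2 ≤ d) {l : ℕ} (hkl : k ≤ l)
    (hl : l + k + 1 ≤ d) : M.gNumber d (l + 1) =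
      ((d + 2).choose (l + 1) : ℤ) *
        ∑ i ∈ Finset.Icc 1 l, (-1) ^ (l - i) * (M.betti F i : ℤ) := by
  have h : (M.gNumber d (l + 1) : ℚ) = ((d + 2).choose (l + 1) : ℚ) *
      ∑ i ∈ Finset.Icc 1 l, (-1) ^ (l - i) * (M.betti F i : ℚ) := by
    rw [M.sum_betti_eq_truncEuler F hM.connected, gNumber_eq_mul_normG _ (by omega),
      hM.truncEuler_eq_normG F hd hkl hl]
  exact_mod_cast h

theorem MemW.betti_eq_zero (hM : M.MemW k d) (hd : 2 * k + 2 ≤ d) {i : ℕ} (hki : k + 1 ≤ i)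
    (hi : i + k + 1 ≤ d) : M.betti F i = 0 := by
  obtain ⟨m, rfl⟩ : ∃ m, i = m + 1 := ⟨i - 1, by omega⟩
  have h := truncEuler_succ_add F hM.connected m
  rw [hM.truncEuler_eq_normG F hd (l := m) (by omega) (by omega),
    hM.truncEuler_eq_normG F hd (l := m + 1) (by omega) (by omega),
    hM.normG_succ_add (j := m + 1) (by omega) (by omega)] at h
  exact_mod_cast h.symm

end

end FiniteComplex

theorem theorem3p7 {V : Type*} [LinearOrder V] (F : Type*) [Field F] (k d : ℕ)
    (M : FiniteComplex V) (hM : M.MemW k d) (hneighbourly : M.IsNeighbourly 2) :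
    (d = 2 * k → ∀ l : ℕ, 1 ≤ l → l + 1 ≤ k →
      ((d + 2).choose (l + 1) : ℤ) * ∑ i ∈ Finset.Icc 1 l, (-1) ^ (l - i) * (M.betti F i : ℤ)
        ≤ M.gNumber d (l + 1)) ∧
    (2 * k + 1 ≤ d → ∀ l : ℕ, 1 ≤ l → l ≤ k →
      ((d + 2).choose (l + 1) : ℤ) * ∑ i ∈ Finset.Icc 1 l, (-1) ^ (l - i) * (M.betti F i : ℤ)
        ≤ M.gNumber d (l + 1)) ∧
    (2 * k + 2 ≤ d → ∀ l : ℕ, k ≤ l → l + k + 1 ≤ d →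
      M.gNumber d (l + 1) =
        ((d + 2).choose (l + 1) : ℤ) *
          ∑ i ∈ Finset.Icc 1 l, (-1) ^ (l - i) * (M.betti F i : ℤ)) ∧
    (2 * k + 2 ≤ d → ∀ i : ℕ, k + 1 ≤ i → i + k + 1 ≤ d → M.betti F i = 0) := by
  -- In both (a) and (b) the range of l lies within l + k + 1 ≤ d.
  exact ⟨fun hd l _ hl => hM.choose_mul_sum_betti_le F (by omega),
    fun hd l _ hl => hM.choose_mul_sum_betti_le F (by omega),
    fun hd l hkl hl => hM.gNumber_eq F hd hkl hl,
    fun hd i hki hi => hM.betti_eq_zero F hd hki hi⟩
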